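/- Let $\Delta=\bigcap_{i=1}^d\{\xi\in\mathbb{R}^n : \langle \xi,u_i\rangle\ge c_i\}$ be a Delzant polytope: $u_1,\dots,u_d\in\mathbb{Z}^n$, $c_i\in\mathbb{R}$, $\Delta$ is compact, and at each vertex of $\Delta$ the vectors $u_i$ with $\langle v,u_i\rangle=c_i$ form a $\mathbb{Z}$-basis of $\mathbb{Z}^n$. For $I\subset\{1,\dots,d\}$ put $\mathbb{C}^d_I=\{z : z_i=0\Leftrightarrow i\in I\}$ and $F(\Delta)_I=\{\xi\in\Delta : \langle\xi,u_i\rangle=c_i\Leftrightarrow i\in I\}$; let $\Sigma_\Delta=\bigcup_{F(\Delta)_I\ne\varnothing}\mathbb{C}^d_I$, an open subset of $\mathbb{C}^d$, let $N_{\mathbb{C}}$ be the kernel of the homomorphism $(\mathbb{C}^\times)^d\to(\mathbb{C}^\times)^n$, $g\mapsto\big(\prod_i g_i^{(u_i)_k}\big)_k$, acting on $\Sigma_\Delta$ by coordinatewise multiplication, let $M_\Delta=\Sigma_\Delta/N_{\mathbb{C}}$ be the toric manifold of $\Delta$, with its affine charts at the vertices of $\Delta$, and let $p:\Sigma_\Delta\to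 M_\Delta$ be the quotient map. Let $\pi\in\wedge^2\mathbb{C}^d$ be a positive bivector, that is, a real bivector on $\mathbb{C}^d=\mathbb{R}^{2d}$ such that $S=\pi^\sharp((\mathbb{C}^d)^*)$ is a complex subspace, multiplication $J$ by $i$ is a symplectic automorphism of $(S,\omega_S)$, where $\omega_S(\pi^\sharp\xi,\pi^\sharp\eta)=\pi(\xi,\eta)$, and $(u,v)\mapsto\omega_S(u,Jv)$ is symmetric and positive definite on $S$. Let $\rho_z(w)=(w_1z_1,\dots,w_dz_d)$ be the infinitesimal action at $z$ of the action $w\cdot z=(e^{w_1}z_1,\dots,e^{w_d}z_d)$ of $\mathbb{C}^d$ on $\Sigma_\Delta$. Then the bivector field $\pi_\Sigma=\wedge^2\rho(\pi)$ is a Poisson structure on $\Sigma_\Delta$, and there is exactly one Poisson structure $\pi_M$ on $M_\Delta$ for which $p:(\Sigma_\Delta,\pi_\Sigma)\to(M_\Delta,\pi_M)$ is a coregular Poisson submersion. This means that $p$ is a surjective submersion with $p_*\pi_\Sigma=\pi_M$ and that each fibre $X$ of $p$ is a coregular submanifold of $(\Sigma_\Delta,\pi_\Sigma)$: an embedded submanifold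 for which $\pi_\Sigma^\sharp(N^*X)$ is a vector subbundle of $T\Sigma_\Delta|_X$ that meets $TX$ trivially. -/

import Mathlib

open scoped Manifold ContDiff Topology

noncomputable section

section Bivectors

/-- A bivector `π ∈ ⋀² V` on a finite-dimensional real vector space `V`, given by the skew-adjoint
map `π♯ : V* → V` which corresponds to it, that is `⟨η, π♯ ξ⟩ = π (ξ, η)`. -/
@[ext]
structure Bivector (V : Type*) [AddCommGroup V] [Module ℝ V] [TopologicalSpace V]
    [IsTopologicalAddGroup V] [ContinuousSMul ℝ V] where
  sharp : StrongDual ℝ V →ₗ[ℝ] V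
  alt : ∀ ξ : StrongDual ℝ V, ξ (sharp ξ) = 0

variable {V W : Type*} [AddCommGroup V] [Module ℝ V] [TopologicalSpace V]
  [IsTopologicalAddGroup V] [ContinuousSMul ℝ V] [AddCommGroup W] [Module ℝ W]
  [TopologicalSpace W] [IsTopologicalAddGroup W] [ContinuousSMul ℝ W]

/-- The value `π (ξ, η)`. -/
def Bivector.pair (π : Bivector V) (ξ η : StrongDual ℝ V) : ℝ := η (π.sharp ξ)

/-- The push-forward `(⋀² L) π`, that is `((⋀² L) π) (ξ, η) = π (ξ ∘ L, η ∘ L)`. -/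
def Bivector.map (L : V →L[ℝ] W) (π : Bivector V) : Bivector W where
  sharp :=
    { toFun := fun ξ => L (π.sharp (ξ.comp L))
      map_add' := fun ξ η => by rw [ContinuousLinearMap.add_comp, map_add, map_add]
      map_smul' := fun c ξ => by rw [ContinuousLinearMap.smul_comp, map_smul, map_smul]; rfl }
  alt := fun ξ => π.alt (ξ.comp L)

/-- The symplectic leaf `S = π♯ (V*)` through the origin of the constant Poisson structure `π`. -/
def Bivector.leaf (π : Bivector V) : Submodule ℝ V := LinearMap.range π.sharp

/-- `π♯ ξ` as an element of the leaf. -/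
def Bivector.toLeaf (π : Bivector V) (ξ : StrongDual ℝ V) : π.leaf := ⟨π.sharp ξ, ξ, rfl⟩

/-- A (real) bivector on a complex vector space is positive if its leaf `S` is a complex subspace,
multiplication `J` by `i` is a symplectic automorphism of `(S, ω_S)`, and `ω_S (u, J v)` is
symmetric and positive definite. Here `ω_S` is the symplectic form of the leaf, the unique form on
`S` with `ω_S (π♯ ξ, π♯ η) = π (ξ, η)`. -/
def Bivector.IsPositive [Module ℂ V] [IsScalarTower ℝ ℂ V] (π : Bivector V) : Prop :=
  ∃ hS : ∀ u ∈ π.leaf, Complex.I • u ∈ π.leaf,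
    ∃ ωS : LinearMap.BilinForm ℝ π.leaf,
      (∀ ξ η : StrongDual ℝ V, ωS (π.toLeaf ξ) (π.toLeaf η) = π.pair ξ η) ∧
      (∀ u v : π.leaf, ωS ⟨Complex.I • (u : V), hS u u.2⟩ ⟨Complex.I • (v : V), hS v v.2⟩ = ωS u v) ∧
      (∀ u v : π.leaf, ωS u ⟨Complex.I • (v : V), hS v v.2⟩ = ωS v ⟨Complex.I • (u : V), hS u u.2⟩) ∧
      (∀ u : π.leaf, u ≠ 0 → 0 < ωS u ⟨Complex.I • (u : V), hS u u.2⟩)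

end Bivectors

section PoissonManifolds

variable {E : Type*} [NormedAddCommGroup E] [NormedSpace ℝ E]
  {M : Type*} [TopologicalSpace M] [ChartedSpace E M]
  {F : Type*} [NormedAddCommGroup F] [NormedSpace ℝ F]
  {N : Type*} [TopologicalSpace N] [ChartedSpace F N]

variable (E M) in
/-- A (not necessarily smooth) field of bivectors on the manifold `M` modelled on `E`. -/
abbrev BivectorField := ∀ x : M, Bivector (TangentSpace 𝓘(ℝ, E) x)

/-- The differential of a function at a point. -/
def differential (f : M → ℝ) (x : M) : StrongDual ℝ (TangentSpace 𝓘(ℝ, E) x) :=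
  mfderiv 𝓘(ℝ, E) 𝓘(ℝ, ℝ) f x

/-- The bracket `{f, g} = π (df, dg)`. -/
def BivectorField.bracket (π : BivectorField E M) (f g : M → ℝ) (x : M) : ℝ :=
  (π x).pair (differential f x) (differential g x)

/-- A Poisson structure on `M`: a smooth bivector field (smooth functions on an open set have a
smooth bracket) whose bracket satisfies the Jacobi identity on local smooth functions. -/
structure BivectorField.IsPoisson (π : BivectorField E M) : Prop where
  smooth : ∀ (U : Set M) (f g : M → ℝ), IsOpen U →
    ContMDiffOn 𝓘(ℝ, E) 𝓘(ℝ, ℝ) ∞ f U → ContMDiffOn 𝓘(ℝ, E) 𝓘(ℝ, ℝ) ∞ g U →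
    ContMDiffOn 𝓘(ℝ, E) 𝓘(ℝ, ℝ) ∞ (π.bracket f g) U
  jacobi : ∀ (U : Set M) (f g h : M → ℝ), IsOpen U →
    ContMDiffOn 𝓘(ℝ, E) 𝓘(ℝ, ℝ) ∞ f U → ContMDiffOn 𝓘(ℝ, E) 𝓘(ℝ, ℝ) ∞ g U →
    ContMDiffOn 𝓘(ℝ, E) 𝓘(ℝ, ℝ) ∞ h U → ∀ x ∈ U,
    π.bracket f (π.bracket g h) x + π.bracket g (π.bracket h f) x
      + π.bracket h (π.bracket f g) x = 0

variable (E) in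
/-- `X` is an embedded submanifold of `M`: around each of its points there is a chart of `M` in
which `X` is an affine subspace. -/
def IsEmbeddedSubmanifold (X : Set M) : Prop :=
  ∀ x ∈ X, ∃ φ ∈ IsManifold.maximalAtlas 𝓘(ℝ, E) ∞ M, x ∈ φ.source ∧
    ∃ L : Submodule ℝ E, ∀ y ∈ φ.source, y ∈ X ↔ φ y - φ x ∈ L

variable (E) in
/-- The tangent space `T_x X`: velocities at `x` of smooth curves of `M` which run in `X`. -/
def tangentVectors (X : Set M) (x : M) : Set (TangentSpace 𝓘(ℝ, E) x) :=
  {v | ∃ γ : ℝ → M, ContMDiff 𝓘(ℝ, ℝ) 𝓘(ℝ, E) ∞ γ ∧ (∀ t, γ t ∈ X) ∧ γ 0 = x ∧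
    (mfderiv 𝓘(ℝ, ℝ) 𝓘(ℝ, E) γ 0 (1 : ℝ) : E) = (v : E)}

variable (E) in
/-- The conormal space `N*_x X`: covectors at `x` which vanish on `T_x X`. -/
def conormalSpace (X : Set M) (x : M) : Submodule ℝ (StrongDual ℝ (TangentSpace 𝓘(ℝ, E) x)) where
  carrier := {ξ | ∀ v ∈ tangentVectors E X x, ξ v = 0}
  add_mem' := fun ha hb v hv => by
    rw [add_apply, ha v hv, hb v hv, add_zero]
  zero_mem' := fun _ _ => rfl
  smul_mem' := fun c ξ h v hv => by
    rw [smul_apply, h v hv, smul_zero]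

/-- The subspace `π♯ (N*_x X)` of `T_x M`. -/
def BivectorField.conormalImage (π : BivectorField E M) (X : Set M) (x : M) :
    Submodule ℝ (TangentSpace 𝓘(ℝ, E) x) :=
  (conormalSpace E X x).map (π x).sharp

/-- A family of subspaces `D_x ⊆ T_x M`, `x ∈ X`, is a smooth vector subbundle of `TM|_X`: it has
local smooth frames. -/
def IsSubbundleAlong [IsManifold 𝓘(ℝ, E) ∞ M] (X : Set M)
    (D : ∀ x : M, Submodule ℝ (TangentSpace 𝓘(ℝ, E) x)) : Prop :=
  ∀ x ∈ X, ∃ (U : Set M) (k : ℕ) (s : Fin k → ∀ y : M, TangentSpace 𝓘(ℝ, E) y),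
    IsOpen U ∧ x ∈ U ∧
    (∀ i, ContMDiffOn 𝓘(ℝ, E) 𝓘(ℝ, E).tangent ∞
      (fun y => (⟨y, s i y⟩ : TangentBundle 𝓘(ℝ, E) M)) U) ∧
    ∀ y ∈ X ∩ U, LinearIndependent ℝ (fun i => s i y) ∧
      Submodule.span ℝ (Set.range fun i => s i y) = D y

/-- `X` is a coregular submanifold of `(M, π)`: an embedded submanifold for which `π♯ (N*X)` is a
vector subbundle of `TM|_X` which meets `TX` trivially. -/
structure BivectorField.IsCoregular [IsManifold 𝓘(ℝ, E) ∞ M] (π : BivectorField E M)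
    (X : Set M) : Prop where
  submanifold : IsEmbeddedSubmanifold E X
  subbundle : IsSubbundleAlong X (π.conormalImage X)
  meets_trivially : ∀ x ∈ X, ∀ v ∈ π.conormalImage X x, v ∈ tangentVectors E X x → v = 0

/-- A coregular Poisson submersion: a surjective submersion between Poisson manifolds which is a
Poisson map (`p_* π = π'`) and whose fibres are coregular submanifolds. -/
structure IsCoregularPoissonSubmersion [IsManifold 𝓘(ℝ, E) ∞ M] [IsManifold 𝓘(ℝ, F) ∞ N]
    (π : BivectorField E M) (π' : BivectorField F N) (p : M → N) : Prop where
  poisson_source : π.IsPoisson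
  poisson_target : π'.IsPoisson
  surjective : Function.Surjective p
  submersion : Manifold.IsSubmersion 𝓘(ℝ, E) 𝓘(ℝ, F) ∞ p
  poisson_map : ∀ x, (π x).map (mfderiv 𝓘(ℝ, E) 𝓘(ℝ, F) p x) = π' (p x)
  coregular_fibres : ∀ y, π.IsCoregular (p ⁻¹' {y})

end PoissonManifolds

section Polytopes

/-- The pairing `⟨ξ, u⟩` of `ξ ∈ 𝔱* = ℝⁿ` with a vector `u` of the lattice `ℤⁿ ⊆ 𝔱 = ℝⁿ`. -/
def latticePairing {n : ℕ} (ξ : Fin n → ℝ) (u : Fin n → ℤ) : ℝ := ∑ k, ξ k * (u k : ℝ)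

/-- The set `{ξ ∈ 𝔱* | ⟨ξ, u_i⟩ ≥ c_i for all i}`. -/
def polyhedron {n d : ℕ} (u : Fin d → Fin n → ℤ) (c : Fin d → ℝ) : Set (Fin n → ℝ) :=
  {ξ | ∀ i, c i ≤ latticePairing ξ (u i)}

/-- A Delzant polytope in the dual of the Lie algebra of the torus `ℝⁿ/ℤⁿ`, with normals `u_i`
already rescaled so as to lie in the lattice `ℤⁿ`: the set `{ξ | ⟨ξ, u_i⟩ ≥ c_i}` is compact, and at
each vertex the normals of the inequalities which are tight there form a `ℤ`-basis of `ℤⁿ`. -/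
structure DelzantPolytope (n d : ℕ) where
  u : Fin d → Fin n → ℤ
  c : Fin d → ℝ
  isCompact : IsCompact (polyhedron u c)
  linearIndependent : ∀ v ∈ (polyhedron u c).extremePoints ℝ,
    LinearIndependent ℤ (fun i : {i // latticePairing v (u i) = c i} => u i)
  span_eq_top : ∀ v ∈ (polyhedron u c).extremePoints ℝ,
    Submodule.span ℤ (Set.range fun i : {i // latticePairing v (u i) = c i} => u i) = ⊤

theorem units_zpow_sum {ι : Type*} (x : ℂˣ) (s : Finset ι) (a : ι → ℤ) :
    x ^ (∑ m ∈ s, a m) = ∏ m ∈ s, x ^ a m := by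
  classical
  induction s using Finset.induction_on with
  | empty => simp
  | insert m s hm ih => rw [Finset.sum_insert hm, Finset.prod_insert hm, zpow_add, ih]

namespace DelzantPolytope

variable {n d : ℕ} (P : DelzantPolytope n d)

/-- The polytope as a subset of `𝔱* = ℝⁿ`. -/
def carrier : Set (Fin n → ℝ) := polyhedron P.u P.c

/-- `F(Δ)_I = {ξ ∈ Δ | ⟨ξ, u_i⟩ = c_i ↔ i ∈ I}`. -/
def face (I : Set (Fin d)) : Set (Fin n → ℝ) :=
  {ξ | ξ ∈ P.carrier ∧ ∀ i, latticePairing ξ (P.u i) = P.c i ↔ i ∈ I}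

/-- `ℂ^d_I = {z ∈ ℂ^d | z_i = 0 ↔ i ∈ I}`. -/
def stratum (I : Set (Fin d)) : Set (Fin d → ℂ) := {z | ∀ i, z i = 0 ↔ i ∈ I}

/-- The union of the strata `ℂ^d_I` over all `I` with `F(Δ)_I ≠ ∅`. -/
def sigmaSet : Set (Fin d → ℂ) := ⋃ (I : Set (Fin d)) (_ : (P.face I).Nonempty), stratum I

/-- The group `N_ℂ`: the kernel of the homomorphism of complex tori `(ℂˣ)^d → (ℂˣ)^n` which sends
the `i`-th one-parameter subgroup to the one of `u_i`, that is `g ↦ (∏_i g_i ^ (u_i)_k)_k`. -/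
def NC : Subgroup (Fin d → ℂˣ) :=
  MonoidHom.ker
    ({ toFun := fun g k => ∏ i, g i ^ P.u i k
       map_one' := by ext k; simp
       map_mul' := fun g h => by ext k; simp [mul_zpow, Finset.prod_mul_distrib] } :
      (Fin d → ℂˣ) →* (Fin n → ℂˣ))


theorem mem_NC_iff (g : Fin d → ℂˣ) : g ∈ P.NC ↔ ∀ k, ∏ i, g i ^ P.u i k = 1 := by
  rw [NC, MonoidHom.mem_ker]
  exact funext_iff

theorem mem_sigmaSet_iff (z : Fin d → ℂ) : z ∈ P.sigmaSet ↔ (P.face {i | z i = 0}).Nonempty := by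
  simp only [sigmaSet, Set.mem_iUnion, stratum, Set.mem_ofPred_eq]
  constructor
  · rintro ⟨I, hI, h⟩
    have : {i | z i = 0} = I := Set.ext h
    rwa [this]
  · exact fun h => ⟨_, h, fun i => Iff.rfl⟩

/-- The vertices of the polytope. -/
def IsVertex (v : Fin n → ℝ) : Prop := v ∈ P.carrier.extremePoints ℝ

/-- An enumeration `u_{σ 1}, …, u_{σ n}` of the normals at some vertex, with the dual basis `b`. -/
structure VertexFrame where
  σ : Fin n → Fin d
  b : Fin n → Fin n → ℤ
  dual : ∀ k l, ∑ m, b k m * P.u (σ l) m = if k = l then 1 else 0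
  vertex : ∃ v, P.IsVertex v ∧ ∀ i, latticePairing v (P.u i) = P.c i ↔ i ∈ Set.range σ

theorem exists_vertexFrame {v : Fin n → ℝ} (hv : P.IsVertex v) :
    ∃ S : P.VertexFrame, ∀ i, latticePairing v (P.u i) = P.c i ↔ i ∈ Set.range S.σ := by
  classical
  let B := Module.Basis.mk (P.linearIndependent v hv) (P.span_eq_top v hv).ge
  have hcard : Fintype.card {i // latticePairing v (P.u i) = P.c i} = n := by
    rw [← Module.finrank_eq_card_basis B]; simp
  let e := (Fintype.equivFinOfCardEq hcard).symm
  have hr : ∀ i, latticePairing v (P.u i) = P.c i ↔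
      i ∈ Set.range (fun k => ((e k : {i // latticePairing v (P.u i) = P.c i}) : Fin d)) := by
    intro i
    constructor
    · exact fun h => ⟨e.symm ⟨i, h⟩, by simp⟩
    · rintro ⟨k, rfl⟩
      exact (e k).2
  refine ⟨⟨fun k => e k, fun k m => B.coord (e k) (Pi.single m 1), ?_, v, hv, hr⟩, hr⟩
  intro k l
  have h1 : P.u (e l) = ∑ m, P.u (e l) m • (Pi.single m (1 : ℤ) : Fin n → ℤ) := by
    ext m; simp [Pi.single_apply, Finset.sum_apply]
  have h2 : B.coord (e k) (P.u (e l)) = if k = l then 1 else 0 := by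
    have : B (e l) = P.u (e l) := by simp [B]
    rw [← this, Module.Basis.coord_apply, Module.Basis.repr_self, Finsupp.single_apply]
    simp [eq_comm]
  rw [← h2]
  conv_rhs => rw [h1]
  rw [map_sum]
  refine Finset.sum_congr rfl fun m _ => ?_
  rw [map_smul, smul_eq_mul, mul_comm]

theorem exists_vertexFrame_of_face {I : Set (Fin d)} (h : (P.face I).Nonempty) :
    ∃ S : P.VertexFrame, I ⊆ Set.range S.σ := by
  obtain ⟨ξ, hξ, hI⟩ := h
  let K : Set (Fin n → ℝ) := {η | η ∈ P.carrier ∧ ∀ i ∈ I, latticePairing η (P.u i) = P.c i}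
  have hc : ∀ i, Continuous fun η : Fin n → ℝ => latticePairing η (P.u i) := by
    intro i; unfold latticePairing; fun_prop
  have hK : IsCompact K := by
    refine P.isCompact.inter_right (t := {η | ∀ i ∈ I, latticePairing η (P.u i) = P.c i}) ?_
    simp only [Set.ofPred_forall]
    exact isClosed_iInter fun i => isClosed_iInter fun _ => isClosed_eq (hc i) continuous_const
  have hadd : ∀ (i : Fin d) (x y : Fin n → ℝ) (a b : ℝ), latticePairing (a • x + b • y) (P.u i)
      = a * latticePairing x (P.u i) + b * latticePairing y (P.u i) := by
    intro i x y a b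
    simp only [latticePairing, Finset.mul_sum, ← Finset.sum_add_distrib]
    refine Finset.sum_congr rfl fun k _ => ?_
    simp only [Pi.add_apply, Pi.smul_apply, smul_eq_mul]; ring
  have hext : IsExtreme ℝ P.carrier K := by
    refine ⟨fun η h => h.1, ?_⟩
    rintro x hx y hy z hz ⟨a, b, ha, hb, hab, rfl⟩
    refine ⟨hx, fun i hi => ?_⟩
    have h1 := hz.2 i hi
    rw [hadd] at h1
    have h2 := hx i
    have h3 := hy i
    by_contra hne
    have h4 : P.c i < latticePairing x (P.u i) := lt_of_le_of_ne h2 (Ne.symm hne)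
    have h5 : a * P.c i + b * P.c i = P.c i := by rw [← add_mul, hab, one_mul]
    nlinarith [mul_lt_mul_of_pos_left h4 ha, mul_le_mul_of_nonneg_left h3 hb.le]
  obtain ⟨v, hv⟩ := hK.extremePoints_nonempty ⟨ξ, hξ, fun i hi => (hI i).2 hi⟩
  obtain ⟨S, hS⟩ := P.exists_vertexFrame (v := v) (hext.extremePoints_subset_extremePoints hv)
  exact ⟨S, fun i hi => (hS i).1 (hv.1.2 i hi)⟩

variable {P}

theorem VertexFrame.dual' (S : P.VertexFrame) (m m' : Fin n) :
    ∑ k, S.b k m * P.u (S.σ k) m' = if m = m' then 1 else 0 := by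
  have h : (Matrix.of S.b) * (Matrix.of fun m l => P.u (S.σ l) m) = 1 := by
    ext k l
    rw [Matrix.mul_apply, Matrix.one_apply]
    exact S.dual k l
  have h' : ((Matrix.of fun m l => P.u (S.σ l) m) * (Matrix.of S.b)) m' m = (1 : Matrix _ _ ℤ) m' m := by
    rw [mul_eq_one_comm.1 h]
  rw [Matrix.mul_apply, Matrix.one_apply] at h'
  simp only [Matrix.of_apply] at h'
  rw [show (if m = m' then (1 : ℤ) else 0) = if m' = m then 1 else 0 by simp [eq_comm], ← h']
  exact Finset.sum_congr rfl fun k _ => mul_comm _ _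

theorem VertexFrame.injective (S : P.VertexFrame) : Function.Injective S.σ := by
  intro k l h
  by_contra hne
  have h1 := S.dual k l
  rw [← h, S.dual k k] at h1
  simp [hne] at h1

theorem VertexFrame.face_nonempty (S : P.VertexFrame) {J : Set (Fin d)}
    (hJ : J ⊆ Set.range S.σ) : (P.face J).Nonempty := by
  classical
  obtain ⟨v, hv, hr⟩ := S.vertex
  let t : Fin n → ℝ := fun k => if S.σ k ∈ J then 0 else 1
  let η : Fin n → ℝ := fun m => ∑ k, t k * S.b k m
  have hη : ∀ l, latticePairing η (P.u (S.σ l)) = t l := by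
    intro l
    have h1 : ∀ k, ∑ m, (S.b k m : ℝ) * (P.u (S.σ l) m : ℝ) = if k = l then 1 else 0 := by
      intro k
      have := congrArg (Int.cast : ℤ → ℝ) (S.dual k l)
      push_cast at this
      exact this
    simp only [latticePairing, η, Finset.sum_mul]
    rw [Finset.sum_comm]
    simp only [mul_assoc, ← Finset.mul_sum, h1]
    simp
  have hlin : ∀ (i : Fin d) (ε : ℝ), latticePairing (v + ε • η) (P.u i)
      = latticePairing v (P.u i) + ε * latticePairing η (P.u i) := by
    intro i ε
    simp only [latticePairing, Finset.mul_sum, ← Finset.sum_add_distrib]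
    refine Finset.sum_congr rfl fun k _ => ?_
    simp only [Pi.add_apply, Pi.smul_apply, smul_eq_mul]; ring
  have hev : ∀ i, i ∉ Set.range S.σ →
      ∀ᶠ ε in 𝓝[>] (0 : ℝ), P.c i < latticePairing (v + ε • η) (P.u i) := by
    intro i hi
    have hlt : P.c i < latticePairing v (P.u i) :=
      lt_of_le_of_ne (hv.1 i) fun h => hi ((hr i).1 h.symm)
    have hcont : Continuous fun ε : ℝ => latticePairing v (P.u i) + ε * latticePairing η (P.u i) := by
      fun_prop
    have := (hcont.tendsto 0).eventually (lt_mem_nhds (by simpa using hlt))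
    refine (this.filter_mono nhdsWithin_le_nhds).mono fun ε h => ?_
    rwa [hlin]
  have hall : ∀ᶠ ε in 𝓝[>] (0 : ℝ), ∀ i, i ∉ Set.range S.σ →
      P.c i < latticePairing (v + ε • η) (P.u i) := by
    rw [Filter.eventually_all]
    intro i
    by_cases hi : i ∈ Set.range S.σ
    · exact Filter.Eventually.of_forall fun _ h => absurd hi h
    · exact (hev i hi).mono fun _ h _ => h
  obtain ⟨ε, hε, hpos⟩ := (hall.and self_mem_nhdsWithin).exists
  have hpos' : 0 < ε := hpos
  have hσ : ∀ l, latticePairing (v + ε • η) (P.u (S.σ l)) = P.c (S.σ l) + ε * t l := by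
    intro l
    rw [hlin, hη, (hr _).2 ⟨l, rfl⟩]
  refine ⟨v + ε • η, fun i => ?_, fun i => ?_⟩
  · by_cases hi : i ∈ Set.range S.σ
    · obtain ⟨l, rfl⟩ := hi
      rw [hσ]
      have : 0 ≤ t l := by simp only [t]; split_ifs <;> norm_num
      nlinarith
    · exact (hε i hi).le
  · by_cases hi : i ∈ Set.range S.σ
    · obtain ⟨l, rfl⟩ := hi
      rw [hσ]
      by_cases hl : S.σ l ∈ J
      · simp [t, hl]
      · simp [t, hl, hpos'.ne']
    · exact ⟨fun h => absurd h (hε i hi).ne', fun h => absurd (hJ h) hi⟩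

variable (P)

theorem isOpen_sigmaSet : IsOpen P.sigmaSet := by
  rw [isOpen_iff_mem_nhds]
  intro z hz
  obtain ⟨S, hS⟩ := P.exists_vertexFrame_of_face ((P.mem_sigmaSet_iff z).1 hz)
  have hev : ∀ᶠ w in 𝓝 z, ∀ i, z i ≠ 0 → w i ≠ 0 := by
    rw [Filter.eventually_all]
    intro i
    by_cases hi : z i = 0
    · exact Filter.Eventually.of_forall fun _ h => absurd hi h
    · exact (((continuous_apply i).tendsto z).eventually_ne hi).mono fun _ h _ => h
  refine hev.mono fun w hw => (P.mem_sigmaSet_iff w).2 (S.face_nonempty fun i hi => hS ?_)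
  by_contra h
  exact hw i h hi

/-- The open set `Σ_Δ ⊆ ℂ^d`. -/
def Sigma : TopologicalSpace.Opens (Fin d → ℂ) := ⟨P.sigmaSet, P.isOpen_sigmaSet⟩

theorem smul_mem_sigma (g : Fin d → ℂˣ) {z : Fin d → ℂ} (hz : z ∈ P.Sigma) : g • z ∈ P.Sigma := by
  have : {i | (g • z) i = 0} = {i | z i = 0} := by
    ext i; simp [Units.smul_def]
  refine (P.mem_sigmaSet_iff _).2 ?_
  rw [this]
  exact (P.mem_sigmaSet_iff _).1 hz

/-- `N_ℂ` acts on `Σ_Δ` by coordinatewise multiplication. -/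
instance : MulAction P.NC P.Sigma where
  smul g z := ⟨(g : Fin d → ℂˣ) • (z : Fin d → ℂ), P.smul_mem_sigma g z.2⟩
  one_smul z := Subtype.ext (one_smul (Fin d → ℂˣ) (z : Fin d → ℂ))
  mul_smul g h z := Subtype.ext (mul_smul (g : Fin d → ℂˣ) (h : Fin d → ℂˣ) (z : Fin d → ℂ))

theorem coe_smul (g : P.NC) (z : P.Sigma) (i : Fin d) :
    (g • z : P.Sigma).1 i = ((g : Fin d → ℂˣ) i : ℂ) * z.1 i := rfl

instance : ContinuousConstSMul P.NC P.Sigma where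
  continuous_const_smul g := by
    refine Continuous.subtype_mk (continuous_pi fun i => ?_) _
    exact continuous_const.mul ((continuous_apply i).comp continuous_subtype_val)

/-- The toric manifold `M_Δ = Σ_Δ / N_ℂ`, with the quotient topology. -/
def M : Type := MulAction.orbitRel.Quotient P.NC P.Sigma

instance : TopologicalSpace P.M :=
  inferInstanceAs (TopologicalSpace (MulAction.orbitRel.Quotient P.NC P.Sigma))

/-- The quotient map `p : Σ_Δ → M_Δ`. -/
def proj (z : P.Sigma) : P.M := Quotient.mk (MulAction.orbitRel P.NC P.Sigma) z

theorem proj_surjective : Function.Surjective P.proj := Quotient.mk_surjective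

theorem continuous_proj : Continuous P.proj := continuous_quotient_mk'

theorem isOpenMap_proj : IsOpenMap P.proj := isOpenMap_quotient_mk'_mul

theorem proj_eq_iff (z w : P.Sigma) : P.proj z = P.proj w ↔ ∃ g : P.NC, g • w = z :=
  Quotient.eq

variable {P}

/-- The exponents `⟨b_k, u_j⟩` of the invariant Laurent monomials attached to a vertex. -/
def VertexFrame.expo (S : P.VertexFrame) (k : Fin n) (j : Fin d) : ℤ := ∑ m, S.b k m * P.u j m

theorem VertexFrame.expo_σ (S : P.VertexFrame) (k l : Fin n) :
    S.expo k (S.σ l) = if k = l then 1 else 0 := S.dual k l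

theorem VertexFrame.sum_expo (S : P.VertexFrame) (j : Fin d) (m : Fin n) :
    ∑ k, S.expo k j * P.u (S.σ k) m = P.u j m := by
  simp only [VertexFrame.expo, Finset.sum_mul]
  rw [Finset.sum_comm]
  have : ∀ m', ∑ k, S.b k m' * P.u j m' * P.u (S.σ k) m = P.u j m' * if m' = m then 1 else 0 := by
    intro m'
    rw [← S.dual' m' m, Finset.mul_sum]
    exact Finset.sum_congr rfl fun k _ => by ring
  simp [this]

/-- The affine coordinates `z ↦ (∏_j z_j ^ ⟨b_k, u_j⟩)_k` attached to a vertex. -/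
def VertexFrame.monomial (S : P.VertexFrame) (z : Fin d → ℂ) : Fin n → ℂ :=
  fun k => ∏ j, z j ^ S.expo k j

/-- The slice `w ↦ z` with `z_{σ k} = w_k` and `z_j = 1` for all other `j`. -/
def VertexFrame.slice (S : P.VertexFrame) (w : Fin n → ℂ) : Fin d → ℂ :=
  Function.extend S.σ w 1

theorem VertexFrame.slice_σ (S : P.VertexFrame) (w : Fin n → ℂ) (k : Fin n) :
    S.slice w (S.σ k) = w k := S.injective.extend_apply _ _ _

theorem VertexFrame.slice_of_notMem (S : P.VertexFrame) (w : Fin n → ℂ) {j : Fin d}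
    (hj : j ∉ Set.range S.σ) : S.slice w j = 1 :=
  Function.extend_apply' _ _ _ fun ⟨k, hk⟩ => hj ⟨k, hk⟩

theorem VertexFrame.slice_mem (S : P.VertexFrame) (w : Fin n → ℂ) : S.slice w ∈ P.Sigma := by
  refine (P.mem_sigmaSet_iff _).2 (S.face_nonempty fun j hj => ?_)
  by_contra h
  rw [Set.mem_ofPred_eq, S.slice_of_notMem w h] at hj
  exact one_ne_zero hj

theorem VertexFrame.continuous_slice (S : P.VertexFrame) : Continuous S.slice := by
  refine continuous_pi fun j => ?_
  by_cases hj : j ∈ Set.range S.σ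
  · obtain ⟨k, rfl⟩ := hj
    simp only [S.slice_σ]
    exact continuous_apply k
  · simp only [S.slice_of_notMem _ hj]
    exact continuous_const

theorem VertexFrame.monomial_smul (S : P.VertexFrame) (g : P.NC) (z : P.Sigma) :
    S.monomial (g • z : P.Sigma).1 = S.monomial z.1 := by
  ext k
  simp only [VertexFrame.monomial, coe_smul, mul_zpow, Finset.prod_mul_distrib]
  have h1 : ∏ j, ((g : Fin d → ℂˣ) j) ^ S.expo k j = 1 := by
    have h2 : ∀ j, ((g : Fin d → ℂˣ) j) ^ S.expo k j
        = ∏ m, (((g : Fin d → ℂˣ) j) ^ P.u j m) ^ S.b k m := by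
      intro j
      simp only [VertexFrame.expo, ← zpow_mul]
      rw [units_zpow_sum]
      exact Finset.prod_congr rfl fun m _ => by rw [mul_comm]
    simp only [h2]
    rw [Finset.prod_comm]
    refine Finset.prod_eq_one fun m _ => ?_
    rw [Finset.prod_zpow, (P.mem_NC_iff g).1 g.2 m, one_zpow]
  have h3 := congrArg (Units.val : ℂˣ → ℂ) h1
  push_cast at h3
  rw [h3, one_mul]

theorem VertexFrame.monomial_slice (S : P.VertexFrame) (w : Fin n → ℂ) :
    S.monomial (S.slice w) = w := by
  ext k
  rw [VertexFrame.monomial, Finset.prod_eq_single (S.σ k)]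
  · rw [S.slice_σ, S.expo_σ, if_pos rfl, zpow_one]
  · intro j _ hj
    by_cases h : j ∈ Set.range S.σ
    · obtain ⟨l, rfl⟩ := h
      rw [S.expo_σ, if_neg (fun h => hj (by rw [h])), zpow_zero]
    · rw [S.slice_of_notMem w h, one_zpow]
  · simp

/-- A point of `Σ_Δ` with `z_j ≠ 0` for all `j` outside a vertex lies on the orbit of a point of the
slice of this vertex. -/
theorem VertexFrame.exists_smul_eq (S : P.VertexFrame) (z : P.Sigma)
    (hz : ∀ j, j ∉ Set.range S.σ → z.1 j ≠ 0) :
    ∃ g : P.NC, g • z = ⟨S.slice (S.monomial z.1), S.slice_mem _⟩ := by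
  classical
  let y : Fin d → ℂˣ := fun j => if h : j ∈ Set.range S.σ then 1 else Units.mk0 (z.1 j) (hz j h)
  have hyσ : ∀ k, y (S.σ k) = 1 := fun k => dif_pos ⟨k, rfl⟩
  have hy : ∀ j, j ∉ Set.range S.σ → (y j : ℂ) = z.1 j := fun j h => by simp only [y, dif_neg h]; rfl
  let g : Fin d → ℂˣ := fun j => (y j)⁻¹ * Function.extend S.σ (fun k => ∏ i, y i ^ S.expo k i) 1 j
  have hgσ : ∀ k, g (S.σ k) = ∏ i, y i ^ S.expo k i := by
    intro k
    simp only [g, hyσ, inv_one, one_mul]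
    exact S.injective.extend_apply _ _ _
  have hext : ∀ j, j ∉ Set.range S.σ →
      Function.extend S.σ (fun k => ∏ i, y i ^ S.expo k i) 1 j = 1 := fun j h =>
    Function.extend_apply' _ _ _ fun ⟨k, hk⟩ => h ⟨k, hk⟩
  have hg : g ∈ P.NC := by
    refine (P.mem_NC_iff g).2 fun m => ?_
    have h1 : ∏ j, Function.extend S.σ (fun k => ∏ i, y i ^ S.expo k i) 1 j ^ P.u j m
        = ∏ i, y i ^ P.u i m := by
      rw [← Finset.prod_subset (Finset.subset_univ (Finset.univ.image S.σ)),
        Finset.prod_image fun a _ b _ h => S.injective h]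
      · simp only [S.injective.extend_apply, ← Finset.prod_zpow]
        rw [Finset.prod_comm]
        refine Finset.prod_congr rfl fun i _ => ?_
        simp only [← zpow_mul]
        rw [← units_zpow_sum, S.sum_expo]
      · intro j _ hj
        rw [hext j (fun ⟨k, hk⟩ => hj (Finset.mem_image.2 ⟨k, Finset.mem_univ _, hk⟩)), one_zpow]
    simp only [g, mul_zpow, Finset.prod_mul_distrib, h1, inv_zpow, Finset.prod_inv_distrib,
      inv_mul_cancel]
  refine ⟨⟨g, hg⟩, Subtype.ext (funext fun j => ?_)⟩
  rw [coe_smul]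
  change (g j : ℂ) * z.1 j = S.slice (S.monomial z.1) j
  by_cases hj : j ∈ Set.range S.σ
  · obtain ⟨k, rfl⟩ := hj
    rw [S.slice_σ, hgσ, VertexFrame.monomial]
    have h2 : ∀ i, z.1 i ^ S.expo k i
        = ((y i : ℂ) ^ S.expo k i) * (if i = S.σ k then z.1 (S.σ k) else 1) := by
      intro i
      by_cases hi : i ∈ Set.range S.σ
      · obtain ⟨l, rfl⟩ := hi
        rw [hyσ, S.expo_σ]
        by_cases h : k = l
        · subst h; simp
        · have h' : S.σ l ≠ S.σ k := fun h' => h (S.injective h').symm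
          simp [h, h']
      · rw [hy i hi, if_neg (fun h => hi ⟨k, h.symm⟩), mul_one]
    simp only [h2, Finset.prod_mul_distrib]
    push_cast
    simp
  · rw [S.slice_of_notMem _ hj]
    simp only [g, hext j hj, mul_one]
    rw [Units.val_inv_eq_inv_val, hy j hj]
    exact inv_mul_cancel₀ (hz j hj)

/-- The set of points of `Σ_Δ` all of whose coordinates outside a vertex are non-zero. -/
def VertexFrame.domain (S : P.VertexFrame) : Set P.Sigma :=
  {z | ∀ j, j ∉ Set.range S.σ → z.1 j ≠ 0}

theorem VertexFrame.isOpen_domain (S : P.VertexFrame) : IsOpen S.domain := by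
  simp only [VertexFrame.domain, Set.ofPred_forall]
  refine isOpen_iInter_of_finite fun j => isOpen_iInter_of_finite fun _ => ?_
  exact isOpen_ne_fun ((continuous_apply j).comp continuous_subtype_val) continuous_const

theorem VertexFrame.smul_mem_domain (S : P.VertexFrame) (g : P.NC) {z : P.Sigma} :
    (g • z : P.Sigma) ∈ S.domain ↔ z ∈ S.domain := by
  simp [VertexFrame.domain, coe_smul]

theorem VertexFrame.proj_mem_image (S : P.VertexFrame) (z : P.Sigma) :
    P.proj z ∈ P.proj '' S.domain ↔ z ∈ S.domain := by
  refine ⟨?_, fun h => ⟨z, h, rfl⟩⟩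
  rintro ⟨w, hw, h⟩
  obtain ⟨g, rfl⟩ := (P.proj_eq_iff w z).1 h
  exact (S.smul_mem_domain g).1 hw

theorem VertexFrame.slice_mem_domain (S : P.VertexFrame) (w : Fin n → ℂ) :
    (⟨S.slice w, S.slice_mem w⟩ : P.Sigma) ∈ S.domain := fun j hj => by
  change S.slice w j ≠ 0
  rw [S.slice_of_notMem w hj]; exact one_ne_zero

/-- The monomials attached to a vertex, as functions on `M_Δ`. -/
def VertexFrame.coord (S : P.VertexFrame) : P.M → (Fin n → ℂ) :=
  Quotient.lift (fun z : P.Sigma => S.monomial z.1) (by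
    rintro z w ⟨g, rfl⟩
    exact S.monomial_smul g w)

theorem VertexFrame.coord_proj (S : P.VertexFrame) (z : P.Sigma) :
    S.coord (P.proj z) = S.monomial z.1 := rfl

theorem VertexFrame.continuousAt_monomial (S : P.VertexFrame) {z : Fin d → ℂ}
    (hz : ∀ j, j ∉ Set.range S.σ → z j ≠ 0) : ContinuousAt S.monomial z := by
  refine continuousAt_pi.2 fun k => ?_
  refine tendsto_finsetProd _ fun j _ => ?_
  by_cases hj : j ∈ Set.range S.σ
  · obtain ⟨l, rfl⟩ := hj
    refine ((continuous_apply (S.σ l)).continuousAt (x := z)).zpow₀ _ (Or.inr ?_)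
    rw [S.expo_σ]; split_ifs <;> simp
  · exact ((continuous_apply j).continuousAt (x := z)).zpow₀ _ (Or.inl (hz j hj))

/-- The affine chart of `M_Δ` at a vertex: its domain is the image of the points with `z_j ≠ 0` for
all `j` outside the vertex, its inverse is induced by the slice. -/
def VertexFrame.chart (S : P.VertexFrame) : OpenPartialHomeomorph P.M (Fin n → ℂ) where
  toFun := S.coord
  invFun w := P.proj ⟨S.slice w, S.slice_mem w⟩
  source := P.proj '' S.domain
  target := Set.univ
  map_source' _ _ := Set.mem_univ _
  map_target' w _ := ⟨_, S.slice_mem_domain w, rfl⟩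
  left_inv' := by
    rintro _ ⟨z, hz, rfl⟩
    obtain ⟨g, hg⟩ := S.exists_smul_eq z hz
    exact (P.proj_eq_iff _ _).2 ⟨g, hg⟩
  right_inv' w _ := S.monomial_slice w
  open_source := P.isOpenMap_proj _ S.isOpen_domain
  open_target := isOpen_univ
  continuousOn_toFun := by
    rintro _ ⟨z, hz, rfl⟩
    refine ContinuousAt.continuousWithinAt ?_
    have h1 : ContinuousAt (S.coord ∘ P.proj) z :=
      (S.continuousAt_monomial hz).comp continuous_subtype_val.continuousAt
    have h2 := (P.isOpenMap_proj.nhds_le z)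
    exact Filter.Tendsto.mono_left (Filter.tendsto_map'_iff.2 h1) h2
  continuousOn_invFun :=
    (P.continuous_proj.comp (S.continuous_slice.subtype_mk _)).continuousOn

variable (P)

theorem exists_mem_chart_source (x : P.M) : ∃ S : P.VertexFrame, x ∈ S.chart.source := by
  obtain ⟨z, rfl⟩ := P.proj_surjective x
  obtain ⟨S, hS⟩ := P.exists_vertexFrame_of_face ((P.mem_sigmaSet_iff z.1).1 z.2)
  exact ⟨S, z, fun j hj h => hj (hS h), rfl⟩

/-- The atlas of `M_Δ` which consists of the affine charts at the vertices. -/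
instance : ChartedSpace (Fin n → ℂ) P.M where
  atlas := Set.range fun S : P.VertexFrame => S.chart
  chartAt x := (P.exists_mem_chart_source x).choose.chart
  mem_chart_source x := (P.exists_mem_chart_source x).choose_spec
  chart_mem_atlas _ := ⟨_, rfl⟩

theorem contDiffOn_transition (S T : P.VertexFrame) :
    ContDiffOn ℂ ω (S.chart.symm ≫ₕ T.chart) (S.chart.symm ≫ₕ T.chart).source := by
  intro w hw
  have hw' : ∀ j, j ∉ Set.range T.σ → S.slice w j ≠ 0 :=
    (T.proj_mem_image ⟨S.slice w, S.slice_mem w⟩).1 hw.2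
  refine ContDiffAt.contDiffWithinAt ?_
  change ContDiffAt ℂ ω (fun w => T.monomial (S.slice w)) w
  refine contDiffAt_pi.2 fun k => contDiffAt_prod fun j _ => ?_
  have hs : ContDiffAt ℂ ω (fun w => S.slice w j) w := by
    by_cases hj : j ∈ Set.range S.σ
    · obtain ⟨l, rfl⟩ := hj
      simp only [S.slice_σ]
      exact contDiffAt_apply ℂ ℂ l w
    · simp only [S.slice_of_notMem _ hj]
      exact contDiffAt_const
  by_cases hj : j ∈ Set.range T.σ
  · obtain ⟨l, rfl⟩ := hj
    simp only [T.expo_σ]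
    split_ifs
    · simpa using hs
    · simpa using contDiffAt_const
  · cases T.expo k j with
    | ofNat a => simpa using hs.pow a
    | negSucc a => simpa [Pi.inv_def] using (hs.pow (a + 1)).inv (pow_ne_zero _ (hw' j hj))

/-- `M_Δ` is a complex manifold. -/
instance : IsManifold 𝓘(ℂ, Fin n → ℂ) ω P.M := by
  refine isManifold_of_contDiffOn _ _ _ ?_
  rintro _ _ ⟨S, rfl⟩ ⟨T, rfl⟩
  simpa using P.contDiffOn_transition S T

/-- The smooth manifold that underlies `M_Δ`. -/
instance : IsManifold 𝓘(ℝ, Fin n → ℂ) ∞ P.M := by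
  refine isManifold_of_contDiffOn _ _ _ ?_
  rintro _ _ ⟨S, rfl⟩ ⟨T, rfl⟩
  simpa using ((P.contDiffOn_transition S T).restrict_scalars ℝ).of_le le_top

/-- The infinitesimal action at `z ∈ Σ_Δ` of the action `w · z = (e ^ w_i z_i)_i` of `ℂ^d`. -/
def infinitesimalAction (z : P.Sigma) :
    (Fin d → ℂ) →L[ℝ] TangentSpace 𝓘(ℝ, Fin d → ℂ) z :=
  ContinuousLinearMap.pi fun i =>
    (ContinuousLinearMap.mul ℝ ℂ).flip (z.1 i) ∘L ContinuousLinearMap.proj (R := ℝ) i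

/-- The bivector field `⋀² ρ (π)` on `Σ_Δ`, where `ρ` is the infinitesimal action of `ℂ^d`. -/
def inducedBivector (π : Bivector (Fin d → ℂ)) : BivectorField (Fin d → ℂ) P.Sigma :=
  fun z => π.map (P.infinitesimalAction z)

end DelzantPolytope

end Polytopes

end

/-! The vector fields `z ↦ a * z` commute, so a constant bivector pushed through them is Poisson
(`logBracket_jacobi`). The quotient map p is equivariant: if A_x denotes the infinitesimal action of
ℂ^d on M_Δ, then dp_z ∘ ρ_z = A_{p z} (`mfderiv_proj_infinitesimalAction`). Hence the push-forward
of π_Σ at z is ∧²A_{p z}(π), which depends on p z alone and so defines π_M. Brackets of π_M pull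
back to brackets of π_Σ, and smoothness and the Jacobi identity descend along local sections.
Uniqueness follows from the surjectivity of p.

For coregularity, the conormal space of a fibre at z consists of the covectors η ∘ dp_z, and π_Σ♯
sends it onto ρ_z(W) with W = {π♯(η ∘ A)}, the same subspace of ℂ^d along the whole fibre.
Positivity makes A injective on W: if u = π♯(η ∘ A) and A u = 0, then ω_S(u, Ju) = -η(A(Ju)) =
-η(J(A u)) = 0, so u = 0. As A = dp ∘ ρ, the map ρ_z is injective on W, so a basis of W gives a
frame, and ρ_z(W) meets ker dp_z, the tangent space of the fibre, trivially.

The geometry of p is read off at a vertex: the k-th monomial is z_{σ k} times a unit in the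
coordinates outside the vertex, so a change of coordinates turns p into a linear projection. -/

noncomputable section

/-! ### Skew-symmetry and positivity -/

section BivectorLemmas

variable {V : Type*} [AddCommGroup V] [Module ℝ V] [TopologicalSpace V]
  [IsTopologicalAddGroup V] [ContinuousSMul ℝ V]

theorem Bivector.pair_swap (π : Bivector V) (ξ η : StrongDual ℝ V) :
    π.pair ξ η = -π.pair η ξ := by
  have h := π.alt (ξ + η)
  simp only [map_add, add_apply, π.alt] at h
  simp only [Bivector.pair]
  linarith

/-- A positive bivector `π` restricts to a complex linear map `L` without kernel on the vectors
`π♯ (η ∘ L)`. -/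
theorem Bivector.IsPositive.sharp_comp_eq_zero [Module ℂ V] [IsScalarTower ℝ ℂ V]
    {X : Type*} [AddCommGroup X] [Module ℝ X] [TopologicalSpace X] [Module ℂ X]
    {π : Bivector V} (hπ : π.IsPositive) (L : V →L[ℝ] X)
    (hL : ∀ v, L (Complex.I • v) = Complex.I • L v) (η : StrongDual ℝ X)
    (h : L (π.sharp (η.comp L)) = 0) : π.sharp (η.comp L) = 0 := by
  obtain ⟨hS, ωS, hω, -, -, hpos⟩ := hπ
  by_contra hne
  have hne' : π.toLeaf (η.comp L) ≠ 0 := fun h0 => hne (congrArg Subtype.val h0)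
  have hlt := hpos _ hne'
  -- Write Ju = π♯ ζ for u = π♯ (η ∘ L). Then ω_S(u, Ju) = -π(ζ, η ∘ L) = -η(L(Ju)), and complex
  -- linearity turns L(Ju) into J(L u) = 0.
  obtain ⟨ζ, hζ⟩ := hS _ (π.toLeaf (η.comp L)).2
  have h1 : (⟨Complex.I • (π.toLeaf (η.comp L) : V), hS _ (π.toLeaf (η.comp L)).2⟩ : π.leaf)
      = π.toLeaf ζ := Subtype.ext hζ.symm
  rw [h1, hω, π.pair_swap] at hlt
  have h2 : π.pair ζ (η.comp L) = 0 := by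
    change η (L (π.sharp ζ)) = 0
    rw [hζ, hL]
    change η (Complex.I • L (π.sharp (η.comp L))) = 0
    rw [h, smul_zero, map_zero]
  rw [h2, neg_zero] at hlt
  exact lt_irrefl _ hlt

end BivectorLemmas

/-! ### Descent of Poisson structures along a submersion -/

section PoissonPushforward

variable {E : Type*} [NormedAddCommGroup E] [NormedSpace ℝ E]
  {M : Type*} [TopologicalSpace M] [ChartedSpace E M]
  {F : Type*} [NormedAddCommGroup F] [NormedSpace ℝ F]
  {N : Type*} [TopologicalSpace N] [ChartedSpace F N]

theorem differential_comp {p : M → N} {f : N → ℝ} {x : M}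
    (hp : MDifferentiableAt 𝓘(ℝ, E) 𝓘(ℝ, F) p x)
    (hf : MDifferentiableAt 𝓘(ℝ, F) 𝓘(ℝ, ℝ) f (p x)) :
    differential (E := E) (f ∘ p) x
      = (differential (E := F) f (p x)).comp (mfderiv 𝓘(ℝ, E) 𝓘(ℝ, F) p x) :=
  mfderiv_comp x hf hp

/-- The bracket sees only germs, so in a nested bracket the inner one may be replaced by a function
that agrees with it near the point. -/
theorem BivectorField.bracket_congr (π : BivectorField E M) {f f' g g' : M → ℝ} {x : M}
    (hf : f =ᶠ[𝓝 x] f') (hg : g =ᶠ[𝓝 x] g') : π.bracket f g x = π.bracket f' g' x := by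
  simp only [BivectorField.bracket, differential, hf.mfderiv_eq, hg.mfderiv_eq]

theorem BivectorField.bracket_comp {π : BivectorField E M} {π' : BivectorField F N} {p : M → N}
    {x : M} (hp : MDifferentiableAt 𝓘(ℝ, E) 𝓘(ℝ, F) p x)
    (hmap : (π x).map (mfderiv 𝓘(ℝ, E) 𝓘(ℝ, F) p x) = π' (p x)) {f g : N → ℝ}
    (hf : MDifferentiableAt 𝓘(ℝ, F) 𝓘(ℝ, ℝ) f (p x))
    (hg : MDifferentiableAt 𝓘(ℝ, F) 𝓘(ℝ, ℝ) g (p x)) :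
    π.bracket (f ∘ p) (g ∘ p) x = π'.bracket f g (p x) := by
  simp only [BivectorField.bracket, differential_comp hp hf, differential_comp hp hg, ← hmap]
  rfl

/-- The push-forward of a Poisson structure along a smooth surjection with local smooth sections is
a Poisson structure. -/
theorem BivectorField.IsPoisson.of_map {π : BivectorField E M} {π' : BivectorField F N}
    (hπ : π.IsPoisson) {p : M → N} (hp : ContMDiff 𝓘(ℝ, E) 𝓘(ℝ, F) ∞ p)
    (hsec : ∀ y, ∃ s : N → M, ContMDiffAt 𝓘(ℝ, F) 𝓘(ℝ, E) ∞ s y ∧ ∀ᶠ y' in 𝓝 y, p (s y') = y')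
    (hmap : ∀ x, (π x).map (mfderiv 𝓘(ℝ, E) 𝓘(ℝ, F) p x) = π' (p x)) : π'.IsPoisson := by
  have hpd : ∀ x, MDifferentiableAt 𝓘(ℝ, E) 𝓘(ℝ, F) p x := fun x =>
    (hp x).mdifferentiableAt (by simp)
  have hdiff : ∀ {U : Set N} {f : N → ℝ}, IsOpen U → ContMDiffOn 𝓘(ℝ, F) 𝓘(ℝ, ℝ) ∞ f U →
      ∀ y ∈ U, MDifferentiableAt 𝓘(ℝ, F) 𝓘(ℝ, ℝ) f y := fun hU hf y hy =>
    (hf.contMDiffAt (hU.mem_nhds hy)).mdifferentiableAt (by simp)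
  have hpull : ∀ {U : Set N} {f : N → ℝ}, ContMDiffOn 𝓘(ℝ, F) 𝓘(ℝ, ℝ) ∞ f U →
      ContMDiffOn 𝓘(ℝ, E) 𝓘(ℝ, ℝ) ∞ (f ∘ p) (p ⁻¹' U) := fun hf =>
    hf.comp hp.contMDiffOn fun _ h => h
  have hbr : ∀ {U : Set N} {f g : N → ℝ}, IsOpen U → ContMDiffOn 𝓘(ℝ, F) 𝓘(ℝ, ℝ) ∞ f U →
      ContMDiffOn 𝓘(ℝ, F) 𝓘(ℝ, ℝ) ∞ g U → ∀ x ∈ p ⁻¹' U,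
      π.bracket (f ∘ p) (g ∘ p) x = π'.bracket f g (p x) := fun hU hf hg x hx =>
    BivectorField.bracket_comp (hpd x) (hmap x) (hdiff hU hf _ hx) (hdiff hU hg _ hx)
  have hsmooth : ∀ (U : Set N) (f g : N → ℝ), IsOpen U →
      ContMDiffOn 𝓘(ℝ, F) 𝓘(ℝ, ℝ) ∞ f U → ContMDiffOn 𝓘(ℝ, F) 𝓘(ℝ, ℝ) ∞ g U →
      ContMDiffOn 𝓘(ℝ, F) 𝓘(ℝ, ℝ) ∞ (π'.bracket f g) U := by
    intro U f g hU hf hg y hy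
    obtain ⟨s, hs, hps⟩ := hsec y
    refine ContMDiffAt.contMDiffWithinAt ?_
    -- Near y the bracket downstairs is the bracket of the pull-backs composed with the section, a
    -- composite of smooth maps.
    have hUp := hU.preimage hp.continuous
    have hsy : s y ∈ p ⁻¹' U := by
      change p (s y) ∈ U
      rwa [hps.self_of_nhds]
    have h1 := ((hπ.smooth _ _ _ hUp (hpull hf) (hpull hg)).contMDiffAt
      (hUp.mem_nhds hsy)).comp y hs
    refine h1.congr_of_eventuallyEq ?_
    filter_upwards [hps, hU.mem_nhds hy] with y' h2 h3
    have h4 := hbr hU hf hg (s y') (by change p (s y') ∈ U; rwa [h2])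
    rw [h2] at h4
    exact h4.symm
  refine ⟨hsmooth, fun U f g h hU hf hg hh y hy => ?_⟩
  obtain ⟨s, -, hps⟩ := hsec y
  have hx : p (s y) = y := hps.self_of_nhds
  -- Only some preimage x of y is needed from here on; substituting y = p x avoids transport between
  -- tangent spaces.
  generalize s y = x at hx
  subst hx
  have hUp := hU.preimage hp.continuous
  have key : ∀ {f g h : N → ℝ}, ContMDiffOn 𝓘(ℝ, F) 𝓘(ℝ, ℝ) ∞ f U →
      ContMDiffOn 𝓘(ℝ, F) 𝓘(ℝ, ℝ) ∞ g U → ContMDiffOn 𝓘(ℝ, F) 𝓘(ℝ, ℝ) ∞ h U →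
      π.bracket (f ∘ p) (π.bracket (g ∘ p) (h ∘ p)) x = π'.bracket f (π'.bracket g h) (p x) := by
    intro f g h hf hg hh
    rw [← hbr hU hf (hsmooth U g h hU hg hh) x hy]
    refine π.bracket_congr Filter.EventuallyEq.rfl ?_
    filter_upwards [hUp.mem_nhds hy] with x' hx'
    exact hbr hU hg hh x' hx'
  rw [← key hf hg hh, ← key hg hh hf, ← key hh hf hg]
  exact hπ.jacobi _ _ _ _ hUp (hpull hf) (hpull hg) (hpull hh) x hy

end PoissonPushforward

/-! ### Calculus on open subsets of a vector space -/

section OpenSubsets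

variable {E : Type*} [NormedAddCommGroup E] [NormedSpace ℝ E] {U : TopologicalSpace.Opens E}
  {F : Type*} [NormedAddCommGroup F] [NormedSpace ℝ F]
  {N : Type*} [TopologicalSpace N] [ChartedSpace F N]

/-- A map on an open subset of a vector space has the derivative of its coordinate expression. -/
theorem hasMFDerivAt_opens {f : U → N} {G : E → F} {x : U} {D : E →L[ℝ] F}
    (hf : ContinuousAt f x) (hG : HasFDerivAt G D x.1)
    (hfG : ∀ᶠ y in 𝓝 x, chartAt F (f x) (f y) = G y.1) :
    HasMFDerivAt 𝓘(ℝ, E) 𝓘(ℝ, F) f x D := by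
  refine ⟨hf, ?_⟩
  -- The chart of an open subset is the inclusion, so the coordinate expression of f agrees with G
  -- near x.
  suffices h : writtenInExtChartAt 𝓘(ℝ, E) 𝓘(ℝ, F) x f =ᶠ[𝓝 x.1] G by
    have h' := HasFDerivAt.congr_of_eventuallyEq hG h
    have hx : (extChartAt 𝓘(ℝ, E) x) x = x.1 := rfl
    rw [← hx] at h'
    exact h'.hasFDerivWithinAt
  obtain ⟨A, hA, hAf⟩ := Filter.eventually_iff_exists_mem.1 hfG
  have h1 : (chartAt E x).target ∈ 𝓝 x.1 :=
    (chartAt E x).open_target.mem_nhds ((chartAt E x).map_source (mem_chart_source E x))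
  have h2 : ContinuousAt (chartAt E x).symm x.1 :=
    (chartAt E x).symm.continuousAt ((chartAt E x).map_source (mem_chart_source E x))
  have h3 : (chartAt E x).symm x.1 = x :=
    (chartAt E x).left_inv (mem_chart_source E x)
  have h4 : (chartAt E x).symm ⁻¹' A ∈ 𝓝 x.1 := h2 (by rwa [h3])
  filter_upwards [h1, h4] with w hw1 hw2
  have h5 : ((chartAt E x).symm w).1 = w :=
    (chartAt E x).right_inv hw1
  have := hAf _ hw2
  rw [h5] at this
  simpa [writtenInExtChartAt] using this

theorem mfderiv_subtype_val (x : U) :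
    mfderiv 𝓘(ℝ, E) 𝓘(ℝ, E) (Subtype.val : U → E) x = ContinuousLinearMap.id ℝ E :=
  (hasMFDerivAt_opens (f := (Subtype.val : U → E)) continuous_subtype_val.continuousAt
    (hasFDerivAt_id x.1) (Filter.Eventually.of_forall fun _ => rfl)).mfderiv

theorem differential_opens {f : U → ℝ} {G : E → ℝ} {x : U} (hG : DifferentiableAt ℝ G x.1)
    (hfG : ∀ᶠ y in 𝓝 x, f y = G y.1) : differential (E := E) f x = fderiv ℝ G x.1 := by
  have hf : ContinuousAt f x := by
    refine ContinuousAt.congr (f := fun y : U => G y.1) ?_ (hfG.mono fun _ h => h.symm)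
    exact ContinuousAt.comp' hG.continuousAt continuous_subtype_val.continuousAt
  exact (hasMFDerivAt_opens hf hG.hasFDerivAt hfG).mfderiv

/-- Smoothness is local and U is open, so the extension by zero is as smooth at points of U as f,
whatever happens on the boundary. -/
theorem contDiffAt_extend {f : U → ℝ} {x : U} {n : WithTop ℕ∞}
    (hf : ContMDiffAt 𝓘(ℝ, E) 𝓘(ℝ, ℝ) n f x) :
    ContDiffAt ℝ n (Function.extend Subtype.val f 0) x.1 := by
  rw [← contMDiffAt_iff_contDiffAt, ← contMDiffAt_subtype_iff]
  simpa [Subtype.val_injective.extend_apply] using hf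

/-- A vector field on an open subset given by a smooth map is smooth. -/
theorem contMDiff_vectorField_opens {v : E → E} (hv : ContDiff ℝ ∞ v) [CompleteSpace E] :
    ContMDiff 𝓘(ℝ, E) 𝓘(ℝ, E).tangent ∞
      (fun x : U => (⟨x, v x.1⟩ : TangentBundle 𝓘(ℝ, E) U)) := by
  intro x
  have h1 : ContMDiffAt 𝓘(ℝ, E) 𝓘(ℝ, E).tangent ∞
      (fun x => (⟨x, v x⟩ : TangentBundle 𝓘(ℝ, E) E)) x.1 := by
    refine (contMDiffAt_vectorSpace_iff_contDiffAt).2 hv.contDiffAt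
  -- The field on U is the pull-back of the ambient field along the inclusion, whose derivative is
  -- the identity.
  have h2 := ContMDiffAt.mpullback_vectorField_preimage (n := ∞) (m := ∞)
    (f := (Subtype.val : U → E)) (x₀ := x) h1 (contMDiff_subtype_val x)
    (by rw [mfderiv_subtype_val]; exact ⟨ContinuousLinearEquiv.refl ℝ E, rfl⟩) (by simp)
  refine h2.congr_of_eventuallyEq (Filter.Eventually.of_forall fun y => ?_)
  have h3 : VectorField.mpullback 𝓘(ℝ, E) 𝓘(ℝ, E) (Subtype.val : U → E) v y = v y.1 := by
    change (mfderiv 𝓘(ℝ, E) 𝓘(ℝ, E) (Subtype.val : U → E) y).inverse (v y.1) = v y.1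
    rw [mfderiv_subtype_val]
    exact congrFun (congrArg DFunLike.coe (ContinuousLinearMap.inverse_id (R := ℝ) (M := E))) (v y.1)
  exact congrArg _ h3.symm

end OpenSubsets

/-! ### The Jacobi identity for bivectors induced by multiplication -/

section LogarithmicBivectors

variable {V : Type*} [NormedCommRing V] [NormedAlgebra ℝ V]

/-- The derivative of `F` along the vector fields `z ↦ a * z`. -/
def logDifferential (F : V → ℝ) (z : V) : StrongDual ℝ V :=
  (fderiv ℝ F z).comp (ContinuousLinearMap.mul ℝ V z)

theorem logDifferential_apply (F : V → ℝ) (z a : V) :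
    logDifferential F z a = fderiv ℝ F z (z * a) := rfl

/-- The second derivative of `F` along the vector fields `z ↦ a * z`. -/
def logHessian (F : V → ℝ) (z a b : V) : ℝ :=
  fderiv ℝ (fderiv ℝ F) z (z * a) (z * b) + fderiv ℝ F z (z * a * b)

/-- Symmetry of the second derivative handles one term and commutativity of V the other; this
expresses that the fields `z ↦ z * a` commute. -/
theorem logHessian_symm {F : V → ℝ} {z : V} (hF : ContDiffAt ℝ ∞ F z) (a b : V) :
    logHessian F z a b = logHessian F z b a := by
  have h2 : minSmoothness ℝ 2 ≤ ∞ := by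
    rw [minSmoothness_of_isRCLikeNormedField]
    exact WithTop.coe_le_coe.2 (le_top : (2 : ℕ∞) ≤ ⊤)
  have h := (hF.isSymmSndFDerivAt h2) (z * a) (z * b)
  rw [logHessian, logHessian, h, mul_right_comm]

theorem ContDiffAt.logDifferential {F : V → ℝ} {z : V} (hF : ContDiffAt ℝ ∞ F z) :
    ContDiffAt ℝ ∞ (logDifferential F) z :=
  (hF.fderiv_right (m := ∞) (by simp)).clm_comp (ContinuousLinearMap.mul ℝ V).contDiff.contDiffAt

/-- Product rule for w ↦ F'(w)(w * b): either F' or the factor w is differentiated. -/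
theorem fderiv_logDifferential {F : V → ℝ} {z : V} (hF : ContDiffAt ℝ ∞ F z) (a b : V) :
    fderiv ℝ (logDifferential F) z (z * a) b = logHessian F z a b := by
  have h1 : HasFDerivAt (fderiv ℝ F) (fderiv ℝ (fderiv ℝ F) z) z :=
    ((hF.fderiv_right (m := ∞) (by simp)).differentiableAt (by simp)).hasFDerivAt
  have h2 := h1.clm_comp (ContinuousLinearMap.mul ℝ V).hasFDerivAt
  rw [show logDifferential F = fun w => (fderiv ℝ F w).comp (ContinuousLinearMap.mul ℝ V w)
    from rfl, h2.fderiv]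
  simp [logHessian, add_comm]

variable [FiniteDimensional ℝ V]

/-- The bracket of the bivector field `⋀² ρ (π)`, where `ρ_z a = z * a`. -/
def logBracket (π : Bivector V) (F G : V → ℝ) (z : V) : ℝ :=
  π.pair (logDifferential F z) (logDifferential G z)

theorem logBracket_eq (π : Bivector V) (F G : V → ℝ) : logBracket π F G = fun z =>
    logDifferential G z (LinearMap.toContinuousLinearMap π.sharp (logDifferential F z)) := rfl

theorem ContDiffAt.logBracket (π : Bivector V) {F G : V → ℝ} {z : V} (hF : ContDiffAt ℝ ∞ F z)
    (hG : ContDiffAt ℝ ∞ G z) : ContDiffAt ℝ ∞ (logBracket π F G) z := by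
  rw [logBracket_eq]
  exact hG.logDifferential.clm_apply
    ((ContinuousLinearMap.contDiff _).contDiffAt.comp z hF.logDifferential)

theorem logDifferential_logBracket (π : Bivector V) {F G : V → ℝ} {z : V}
    (hF : ContDiffAt ℝ ∞ F z) (hG : ContDiffAt ℝ ∞ G z) (a : V) :
    logDifferential (logBracket π F G) z a
      = logHessian G z a (π.sharp (logDifferential F z))
        - logHessian F z a (π.sharp (logDifferential G z)) := by
  have hF' := (hF.logDifferential.differentiableAt (by simp)).hasFDerivAt
  have hG' := (hG.logDifferential.differentiableAt (by simp)).hasFDerivAt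
  have h := hG'.clm_apply
    ((LinearMap.toContinuousLinearMap π.sharp).hasFDerivAt.comp z hF')
  rw [logDifferential_apply, logBracket_eq]
  erw [h.fderiv]
  -- Skew-symmetry moves the derivative of the F-covector out of π♯, which produces the minus sign
  -- in front of the Hessian of F.
  have h1 := π.pair_swap (fderiv ℝ (logDifferential F) z (z * a)) (logDifferential G z)
  simp only [Bivector.pair, fderiv_logDifferential hF] at h1
  simp [fderiv_logDifferential hG, h1]
  ring

/-- With X_F = π♯(dF), dF the logarithmic differential, {F, {G, H}} = Hess H(X_F, X_G) - Hess G(X_F,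
X_H). In the cyclic sum each Hessian occurs twice with opposite signs and swapped arguments. -/
theorem logBracket_jacobi (π : Bivector V) {F G H : V → ℝ} {z : V} (hF : ContDiffAt ℝ ∞ F z)
    (hG : ContDiffAt ℝ ∞ G z) (hH : ContDiffAt ℝ ∞ H z) :
    logBracket π F (logBracket π G H) z + logBracket π G (logBracket π H F) z
      + logBracket π H (logBracket π F G) z = 0 := by
  have key : ∀ {F G H : V → ℝ}, ContDiffAt ℝ ∞ G z → ContDiffAt ℝ ∞ H z →
      logBracket π F (logBracket π G H) z
        = logHessian H z (π.sharp (logDifferential F z)) (π.sharp (logDifferential G z))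
          - logHessian G z (π.sharp (logDifferential F z)) (π.sharp (logDifferential H z)) :=
    fun hG hH => logDifferential_logBracket π hG hH _
  rw [key hG hH, key hH hF, key hF hG, logHessian_symm hF, logHessian_symm hG, logHessian_symm hH]
  ring

/-- On an open subset, a bivector field which is induced by a constant bivector through the vector
fields `z ↦ z * a` is a Poisson structure. -/
theorem isPoisson_of_bracket_eq_logBracket {U : TopologicalSpace.Opens V} (π : Bivector V)
    (B : BivectorField V U)
    (h : ∀ (z : U) (ξ : StrongDual ℝ V), ((B z).sharp ξ : V)
      = z.1 * π.sharp (ξ.comp (ContinuousLinearMap.mul ℝ V z.1))) :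
    B.IsPoisson := by
  have hbr : ∀ {f g : U → ℝ} {F G : V → ℝ} {z : U}, ContDiffAt ℝ ∞ F z.1 → ContDiffAt ℝ ∞ G z.1 →
      (∀ᶠ y in 𝓝 z, f y = F y.1) → (∀ᶠ y in 𝓝 z, g y = G y.1) →
      B.bracket f g z = logBracket π F G z.1 := by
    intro f g F G z hF hG hfF hgG
    rw [BivectorField.bracket, differential_opens (hF.differentiableAt (by simp)) hfF,
      differential_opens (hG.differentiableAt (by simp)) hgG]
    exact congrArg (fderiv ℝ G z.1) (h z (fderiv ℝ F z.1))
  have hext : ∀ (f : U → ℝ) (z : U), f z = Function.extend Subtype.val f 0 z.1 := fun f z =>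
    (Subtype.val_injective.extend_apply f 0 z).symm
  have hsm : ∀ {A : Set U} {f : U → ℝ}, IsOpen A → ContMDiffOn 𝓘(ℝ, V) 𝓘(ℝ, ℝ) ∞ f A →
      ∀ z ∈ A, ContDiffAt ℝ ∞ (Function.extend Subtype.val f 0) z.1 := fun hA hf z hz =>
    contDiffAt_extend (hf.contMDiffAt (hA.mem_nhds hz))
  have hbr' : ∀ {A : Set U} {f g : U → ℝ}, IsOpen A → ContMDiffOn 𝓘(ℝ, V) 𝓘(ℝ, ℝ) ∞ f A →
      ContMDiffOn 𝓘(ℝ, V) 𝓘(ℝ, ℝ) ∞ g A → ∀ z ∈ A, B.bracket f g z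
        = logBracket π (Function.extend Subtype.val f 0) (Function.extend Subtype.val g 0) z.1 :=
    fun hA hf hg z hz => hbr (hsm hA hf z hz) (hsm hA hg z hz)
      (Filter.Eventually.of_forall (hext _)) (Filter.Eventually.of_forall (hext _))
  refine ⟨fun A f g hA hf hg z hz => ?_, fun A f g k hA hf hg hk z hz => ?_⟩
  · refine ContMDiffAt.contMDiffWithinAt ?_
    have h1 := contMDiffAt_subtype_iff.2 (contMDiffAt_iff_contDiffAt.2
      ((hsm hA hf z hz).logBracket π (hsm hA hg z hz)))
    refine h1.congr_of_eventuallyEq ?_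
    filter_upwards [hA.mem_nhds hz] with y hy using hbr' hA hf hg y hy
  · have key : ∀ {f g k : U → ℝ}, ContMDiffOn 𝓘(ℝ, V) 𝓘(ℝ, ℝ) ∞ f A →
        ContMDiffOn 𝓘(ℝ, V) 𝓘(ℝ, ℝ) ∞ g A → ContMDiffOn 𝓘(ℝ, V) 𝓘(ℝ, ℝ) ∞ k A →
        B.bracket f (B.bracket g k) z = logBracket π (Function.extend Subtype.val f 0)
          (logBracket π (Function.extend Subtype.val g 0) (Function.extend Subtype.val k 0)) z.1 :=
      fun hf hg hk => hbr (hsm hA hf z hz) ((hsm hA hg z hz).logBracket π (hsm hA hk z hz))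
        (Filter.Eventually.of_forall (hext _))
        -- The inner bracket agrees with its ambient counterpart only on A, which is enough near z.
        (by filter_upwards [hA.mem_nhds hz] with y hy using hbr' hA hg hk y hy)
    rw [key hf hg hk, key hg hk hf, key hk hf hg]
    exact logBracket_jacobi π (hsm hA hf z hz) (hsm hA hg z hz) (hsm hA hk z hz)

end LogarithmicBivectors

/-! ### Coordinates that straighten the quotient map at a vertex -/

namespace DelzantPolytope

variable {n d : ℕ} {P : DelzantPolytope n d}

/-- The points of `ℂ^d` all of whose coordinates outside a vertex are non-zero. -/
def VertexFrame.nonvanishing (S : P.VertexFrame) : Set (Fin d → ℂ) :=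
  {z | ∀ j, j ∉ Set.range S.σ → z j ≠ 0}

theorem VertexFrame.isOpen_nonvanishing (S : P.VertexFrame) : IsOpen S.nonvanishing := by
  simp only [VertexFrame.nonvanishing, Set.ofPred_forall]
  exact isOpen_iInter_of_finite fun j => isOpen_iInter_of_finite fun _ =>
    isOpen_ne_fun (continuous_apply j) continuous_const

/-- Coordinates at the vertex, which may vanish, occur only with exponent 0 or 1; negative powers
involve non-zero coordinates only. -/
theorem VertexFrame.contDiffAt_monomial (S : P.VertexFrame) {z : Fin d → ℂ}
    (hz : z ∈ S.nonvanishing) : ContDiffAt ℝ ∞ S.monomial z := by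
  refine contDiffAt_pi.2 fun k => contDiffAt_prod fun j _ => ?_
  have hs : ContDiffAt ℝ ∞ (fun w : Fin d → ℂ => w j) z := contDiffAt_apply ℝ ℂ j z
  by_cases hj : j ∈ Set.range S.σ
  · obtain ⟨l, rfl⟩ := hj
    simp only [S.expo_σ]
    split_ifs
    · simpa using hs
    · simpa using contDiffAt_const
  · cases S.expo k j with
    | ofNat a => simpa using hs.pow a
    | negSucc a => simpa [Pi.inv_def] using (hs.pow (a + 1)).inv (pow_ne_zero _ (hz j hj))

/-- The coordinates at a vertex replaced by `1`. -/
def VertexFrame.outer (S : P.VertexFrame) (z : Fin d → ℂ) : Fin d → ℂ :=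
  Function.extend S.σ 1 z

theorem VertexFrame.outer_σ (S : P.VertexFrame) (z : Fin d → ℂ) (k : Fin n) :
    S.outer z (S.σ k) = 1 := S.injective.extend_apply _ _ _

theorem VertexFrame.outer_of_notMem (S : P.VertexFrame) (z : Fin d → ℂ) {j : Fin d}
    (hj : j ∉ Set.range S.σ) : S.outer z j = z j :=
  Function.extend_apply' _ _ _ fun ⟨k, hk⟩ => hj ⟨k, hk⟩

theorem VertexFrame.outer_congr (S : P.VertexFrame) {z w : Fin d → ℂ}
    (h : ∀ j, j ∉ Set.range S.σ → z j = w j) : S.outer z = S.outer w := by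
  ext j
  by_cases hj : j ∈ Set.range S.σ
  · obtain ⟨k, rfl⟩ := hj
    rw [S.outer_σ, S.outer_σ]
  · rw [S.outer_of_notMem _ hj, S.outer_of_notMem _ hj, h j hj]

theorem VertexFrame.outer_mem (S : P.VertexFrame) {z : Fin d → ℂ} (hz : z ∈ S.nonvanishing) :
    S.outer z ∈ S.nonvanishing := fun j hj => by
  rw [S.outer_of_notMem z hj]
  exact hz j hj

/-- By duality of the bases, `z (S.σ k)` is the only vertex coordinate in the k-th monomial and its
exponent is 1. The other factor is a unit that ignores the vertex coordinates, so the coordinate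
change can be inverted by division. -/
theorem VertexFrame.monomial_eq (S : P.VertexFrame) (z : Fin d → ℂ) (k : Fin n) :
    S.monomial z k = z (S.σ k) * S.monomial (S.outer z) k := by
  classical
  have h : ∀ j, z j ^ S.expo k j
      = (if j = S.σ k then z (S.σ k) else 1) * S.outer z j ^ S.expo k j := by
    intro j
    by_cases hj : j ∈ Set.range S.σ
    · obtain ⟨l, rfl⟩ := hj
      rw [S.outer_σ, S.expo_σ, one_zpow, mul_one]
      by_cases hkl : k = l
      · subst hkl; simp
      · rw [if_neg hkl, if_neg fun h => hkl (S.injective h).symm, zpow_zero]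
    · rw [S.outer_of_notMem z hj, if_neg fun h => hj ⟨k, h.symm⟩, one_mul]
  simp only [VertexFrame.monomial, h, Finset.prod_mul_distrib]
  simp

theorem VertexFrame.monomial_outer_ne_zero (S : P.VertexFrame) {z : Fin d → ℂ}
    (hz : z ∈ S.nonvanishing) (k : Fin n) : S.monomial (S.outer z) k ≠ 0 := by
  refine Finset.prod_ne_zero_iff.2 fun j _ => zpow_ne_zero _ ?_
  by_cases hj : j ∈ Set.range S.σ
  · obtain ⟨l, rfl⟩ := hj
    rw [S.outer_σ]
    exact one_ne_zero
  · exact S.outer_mem hz j hj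

/-- The coordinates at a vertex replaced by `w`. -/
def VertexFrame.replace (S : P.VertexFrame) (w : Fin n → ℂ) (z : Fin d → ℂ) : Fin d → ℂ :=
  Function.extend S.σ w z

theorem VertexFrame.replace_σ (S : P.VertexFrame) (w : Fin n → ℂ) (z : Fin d → ℂ) (k : Fin n) :
    S.replace w z (S.σ k) = w k := S.injective.extend_apply _ _ _

theorem VertexFrame.replace_of_notMem (S : P.VertexFrame) (w : Fin n → ℂ) (z : Fin d → ℂ)
    {j : Fin d} (hj : j ∉ Set.range S.σ) : S.replace w z j = z j :=
  Function.extend_apply' _ _ _ fun ⟨k, hk⟩ => hj ⟨k, hk⟩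

theorem VertexFrame.outer_replace (S : P.VertexFrame) (w : Fin n → ℂ) (z : Fin d → ℂ) :
    S.outer (S.replace w z) = S.outer z :=
  S.outer_congr fun _ hj => S.replace_of_notMem w z hj

theorem VertexFrame.replace_mem (S : P.VertexFrame) (w : Fin n → ℂ) {z : Fin d → ℂ}
    (hz : z ∈ S.nonvanishing) : S.replace w z ∈ S.nonvanishing := fun j hj => by
  rw [S.replace_of_notMem w z hj]
  exact hz j hj

theorem VertexFrame.contDiffAt_replace (S : P.VertexFrame) {w : (Fin d → ℂ) → Fin n → ℂ}
    {z : Fin d → ℂ} (hw : ContDiffAt ℝ ∞ w z) :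
    ContDiffAt ℝ ∞ (fun z => S.replace (w z) z) z := by
  refine contDiffAt_pi.2 fun j => ?_
  by_cases hj : j ∈ Set.range S.σ
  · obtain ⟨k, rfl⟩ := hj
    simp only [S.replace_σ]
    exact contDiffAt_pi.1 hw k
  · simp only [S.replace_of_notMem _ _ hj]
    exact contDiffAt_apply ℝ ℂ j z

theorem VertexFrame.contDiff_outer (S : P.VertexFrame) : ContDiff ℝ ∞ S.outer :=
  contDiff_iff_contDiffAt.2 fun _ => S.contDiffAt_replace (w := fun _ => 1) contDiffAt_const

/-- The inverse of the coordinate change `z ↦ S.replace (S.monomial z) z`. -/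
def VertexFrame.unstraighten (S : P.VertexFrame) (z : Fin d → ℂ) : Fin d → ℂ :=
  S.replace (fun k => z (S.σ k) * (S.monomial (S.outer z) k)⁻¹) z

theorem VertexFrame.monomial_unstraighten (S : P.VertexFrame) {z : Fin d → ℂ}
    (hz : z ∈ S.nonvanishing) : S.monomial (S.unstraighten z) = fun k => z (S.σ k) := by
  ext k
  rw [S.monomial_eq, VertexFrame.unstraighten, S.outer_replace, S.replace_σ,
    inv_mul_cancel_right₀ (S.monomial_outer_ne_zero hz k)]

theorem VertexFrame.contDiffAt_unstraighten (S : P.VertexFrame) {z : Fin d → ℂ}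
    (hz : z ∈ S.nonvanishing) : ContDiffAt ℝ ∞ S.unstraighten z := by
  refine S.contDiffAt_replace (contDiffAt_pi.2 fun k => ?_)
  refine (contDiffAt_apply ℝ ℂ (S.σ k) z).mul (ContDiffAt.inv ?_ (S.monomial_outer_ne_zero hz k))
  exact contDiffAt_pi.1
    ((S.contDiffAt_monomial (S.outer_mem hz)).comp z S.contDiff_outer.contDiffAt) k

/-- The coordinates of `ℂ^d` in which the monomials attached to a vertex are linear. -/
def VertexFrame.straighten (S : P.VertexFrame) :
    OpenPartialHomeomorph (Fin d → ℂ) (Fin d → ℂ) where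
  toFun z := S.replace (S.monomial z) z
  invFun := S.unstraighten
  source := S.nonvanishing
  target := S.nonvanishing
  map_source' _ hz := S.replace_mem _ hz
  map_target' _ hz := S.replace_mem _ hz
  left_inv' z hz := by
    ext j
    by_cases hj : j ∈ Set.range S.σ
    · obtain ⟨k, rfl⟩ := hj
      rw [VertexFrame.unstraighten, S.replace_σ, S.outer_replace, S.replace_σ, S.monomial_eq,
        mul_inv_cancel_right₀ (S.monomial_outer_ne_zero hz k)]
    · rw [VertexFrame.unstraighten, S.replace_of_notMem _ _ hj, S.replace_of_notMem _ _ hj]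
  right_inv' z hz := by
    ext j
    by_cases hj : j ∈ Set.range S.σ
    · obtain ⟨k, rfl⟩ := hj
      rw [S.replace_σ, S.monomial_unstraighten hz]
    · rw [S.replace_of_notMem _ _ hj, VertexFrame.unstraighten, S.replace_of_notMem _ _ hj]
  open_source := S.isOpen_nonvanishing
  open_target := S.isOpen_nonvanishing
  continuousOn_toFun _ hz :=
    (S.contDiffAt_replace (S.contDiffAt_monomial hz)).continuousAt.continuousWithinAt
  continuousOn_invFun _ hz := (S.contDiffAt_unstraighten hz).continuousAt.continuousWithinAt

/-- The coordinates on `Σ_Δ` in which the monomials attached to a vertex are linear. -/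
def VertexFrame.straightChart (S : P.VertexFrame) :
    OpenPartialHomeomorph P.Sigma (Fin d → ℂ) :=
  -- The point of the slice only witnesses that Σ_Δ is non-empty.
  S.straighten.subtypeRestr ⟨⟨S.slice 0, S.slice_mem 0⟩⟩

theorem VertexFrame.straightChart_apply (S : P.VertexFrame) (z : P.Sigma) :
    S.straightChart z = S.replace (S.monomial z.1) z.1 := rfl

theorem VertexFrame.straightChart_source (S : P.VertexFrame) :
    S.straightChart.source = S.domain :=
  S.straighten.subtypeRestr_source _

theorem VertexFrame.straightChart_mem_maximalAtlas (S : P.VertexFrame) :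
    S.straightChart ∈ IsManifold.maximalAtlas 𝓘(ℝ, Fin d → ℂ) ∞ P.Sigma := by
  refine OpenPartialHomeomorph.mem_maximalAtlas_of_contMDiffOn _ (fun z hz => ?_) fun w hw => ?_
  · rw [S.straightChart_source] at hz
    exact (contMDiffAt_subtype_iff.2 (contMDiffAt_iff_contDiffAt.2
      (S.contDiffAt_replace (S.contDiffAt_monomial hz)))).contMDiffWithinAt
  · refine (ContMDiffWithinAt.subtypeVal_comp_iff _ _ _ _).1 ?_
    refine ContMDiffWithinAt.congr_of_mem (f := S.unstraighten) ?_
      (fun w hw => S.straighten.subtypeRestr_symm_apply _ hw) hw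
    exact (contMDiffAt_iff_contDiffAt.2 (S.contDiffAt_unstraighten
      (S.straighten.subtypeRestr_target_subset _ hw))).contMDiffWithinAt

/-- In straightened coordinates the quotient map is a projection. -/
theorem VertexFrame.coord_proj_straightChart_symm (S : P.VertexFrame) {w : Fin d → ℂ}
    (hw : w ∈ S.straightChart.target) :
    S.coord (P.proj (S.straightChart.symm w)) = fun k => w (S.σ k) := by
  have h := S.straightChart.right_inv hw
  ext k
  rw [S.coord_proj]
  conv_rhs => rw [← h]
  rw [S.straightChart_apply, S.replace_σ]

end DelzantPolytope

/-- A surjective linear map of finite-dimensional spaces is, up to an isomorphism of its source, the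
projection of a product whose second factor depends only on the dimensions. -/
theorem ContinuousLinearMap.exists_equiv_prod_of_surjective {E F : Type*} [NormedAddCommGroup E]
    [NormedSpace ℝ E] [FiniteDimensional ℝ E] [NormedAddCommGroup F] [NormedSpace ℝ F]
    [FiniteDimensional ℝ F] (L : E →L[ℝ] F) (hL : Function.Surjective L) :
    ∃ e : E ≃L[ℝ] F × (Fin (Module.finrank ℝ E - Module.finrank ℝ F) → ℝ),
      ∀ x, (e x).1 = L x := by
  obtain ⟨s, hs⟩ := (L : E →ₗ[ℝ] F).exists_rightInverse_of_surjective (LinearMap.range_eq_top.2 hL)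
  obtain ⟨K, hK⟩ := (LinearMap.ker (L : E →ₗ[ℝ] F)).exists_isCompl
  let p := (LinearMap.ker (L : E →ₗ[ℝ] F)).projectionOnto K hK
  have hker : Module.finrank ℝ (LinearMap.ker (L : E →ₗ[ℝ] F))
      = Module.finrank ℝ E - Module.finrank ℝ F := by
    have h := (L : E →ₗ[ℝ] F).finrank_range_add_finrank_ker
    rw [LinearMap.range_eq_top.2 hL, finrank_top] at h
    omega
  let q : LinearMap.ker (L : E →ₗ[ℝ] F) ≃ₗ[ℝ]
      (Fin (Module.finrank ℝ E - Module.finrank ℝ F) → ℝ) :=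
    LinearEquiv.ofFinrankEq _ _ (by rw [hker, Module.finrank_fin_fun])
  let e : E →ₗ[ℝ] F × (Fin (Module.finrank ℝ E - Module.finrank ℝ F) → ℝ) :=
    (L : E →ₗ[ℝ] F).prod (q.toLinearMap ∘ₗ p)
  have hinj : Function.Injective e := by
    refine (injective_iff_map_eq_zero e).2 fun x hx => ?_
    have h1 : L x = 0 := congrArg Prod.fst hx
    have h2 : q (p x) = 0 := congrArg Prod.snd hx
    have h3 : p x = 0 := by simpa using h2
    have h4 : p x = ⟨x, h1⟩ := Submodule.projectionOnto_apply_left hK ⟨x, h1⟩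
    exact congrArg Subtype.val (h4.symm.trans h3)
  have hdim : Module.finrank ℝ E = Module.finrank ℝ
      (F × (Fin (Module.finrank ℝ E - Module.finrank ℝ F) → ℝ)) := by
    rw [Module.finrank_prod, Module.finrank_fin_fun]
    have := LinearMap.finrank_le_finrank_of_surjective (f := (L : E →ₗ[ℝ] F)) hL
    omega
  exact ⟨(LinearMap.linearEquivOfInjective e hinj hdim).toContinuousLinearEquiv, fun x => rfl⟩

/-! ### The quotient map as a submersion, its sections and fibres -/

namespace DelzantPolytope

variable {n d : ℕ} {P : DelzantPolytope n d}

theorem VertexFrame.chart_mem_maximalAtlas (S : P.VertexFrame) :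
    S.chart ∈ IsManifold.maximalAtlas 𝓘(ℝ, Fin n → ℂ) ∞ P.M :=
  StructureGroupoid.subset_maximalAtlas _ ⟨S, rfl⟩

theorem VertexFrame.proj_mem_chart_source (S : P.VertexFrame) {z : P.Sigma} :
    P.proj z ∈ S.chart.source ↔ z ∈ S.domain := S.proj_mem_image z

theorem isSubmersion_proj :
    Manifold.IsSubmersion 𝓘(ℝ, Fin d → ℂ) 𝓘(ℝ, Fin n → ℂ) ∞ P.proj := by
  -- One complement must serve all points, so the kernel of the projection, which varies with the
  -- vertex, is replaced by a coordinate space of its dimension.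
  refine ⟨Fin (Module.finrank ℝ (Fin d → ℂ) - Module.finrank ℝ (Fin n → ℂ)) → ℝ,
    inferInstance, inferInstance, fun z => ?_⟩
  obtain ⟨S, hS⟩ := P.exists_mem_chart_source (P.proj z)
  let L : (Fin d → ℂ) →L[ℝ] (Fin n → ℂ) :=
    ContinuousLinearMap.pi fun k => ContinuousLinearMap.proj (S.σ k)
  have hL : Function.Surjective L := fun w => ⟨S.slice w, funext fun k => S.slice_σ w k⟩
  obtain ⟨e, he⟩ := L.exists_equiv_prod_of_surjective hL
  have hz := S.proj_mem_chart_source.1 hS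
  refine Manifold.IsSubmersionAtOfComplement.mk_of_charts e S.straightChart S.chart
    (by rwa [S.straightChart_source]) hS S.straightChart_mem_maximalAtlas
    S.chart_mem_maximalAtlas (fun w hw => ?_) fun w hw => ?_
  · rw [S.straightChart_source] at hw
    exact S.proj_mem_chart_source.2 hw
  · have hw' : w ∈ S.straightChart.target := by simpa using hw
    exact (S.coord_proj_straightChart_symm hw').trans (he w).symm

theorem contMDiff_proj : ContMDiff 𝓘(ℝ, Fin d → ℂ) 𝓘(ℝ, Fin n → ℂ) ∞ P.proj :=
  isSubmersion_proj.contMDiff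

/-- The slice at a vertex is a section over the whole affine chart. -/
theorem exists_section (y : P.M) : ∃ s : P.M → P.Sigma,
    ContMDiffAt 𝓘(ℝ, Fin n → ℂ) 𝓘(ℝ, Fin d → ℂ) ∞ s y ∧ ∀ᶠ y' in 𝓝 y, P.proj (s y') = y' := by
  obtain ⟨S, hS⟩ := P.exists_mem_chart_source y
  refine ⟨fun x => ⟨S.slice (S.coord x), S.slice_mem _⟩, ?_, ?_⟩
  · refine (ContMDiffAt.subtypeVal_comp_iff _ _ _).1 ?_
    have hslice : ContDiff ℝ ∞ S.slice := by
      refine contDiff_pi.2 fun j => ?_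
      by_cases hj : j ∈ Set.range S.σ
      · obtain ⟨k, rfl⟩ := hj
        simp only [S.slice_σ]
        exact contDiff_apply ℝ ℂ k
      · simp only [S.slice_of_notMem _ hj]
        exact contDiff_const
    exact hslice.contMDiff.contMDiffAt.comp y
      (contMDiffAt_of_mem_maximalAtlas S.chart_mem_maximalAtlas hS)
  · filter_upwards [S.chart.open_source.mem_nhds hS] with y' hy' using S.chart.left_inv hy'

theorem VertexFrame.proj_eq_proj_iff (S : P.VertexFrame) {z w : P.Sigma} (hz : z ∈ S.domain)
    (hw : w ∈ S.domain) : P.proj z = P.proj w ↔ S.monomial z.1 = S.monomial w.1 :=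
  (S.chart.injOn.eq_iff (S.proj_mem_chart_source.2 hz) (S.proj_mem_chart_source.2 hw)).symm

/-- In the straightened chart a fibre is the affine subspace on which the vertex coordinates are
constant. -/
theorem isEmbeddedSubmanifold_fibre (y : P.M) :
    IsEmbeddedSubmanifold (Fin d → ℂ) (P.proj ⁻¹' {y}) := by
  rintro x rfl
  obtain ⟨S, hS⟩ := P.exists_mem_chart_source (P.proj x)
  have hx := S.proj_mem_chart_source.1 hS
  refine ⟨S.straightChart, S.straightChart_mem_maximalAtlas, by rwa [S.straightChart_source],
    LinearMap.ker (LinearMap.funLeft ℝ ℂ S.σ), fun z hz => ?_⟩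
  rw [S.straightChart_source] at hz
  rw [LinearMap.mem_ker, map_sub, sub_eq_zero, Set.mem_preimage, Set.mem_singleton_iff,
    S.proj_eq_proj_iff hz hx, funext_iff, funext_iff]
  simp only [LinearMap.funLeft_apply, S.straightChart_apply, S.replace_σ]

/-- The linear map from `ℂ^d` to `ℂ^n` which the projection induces on Lie algebras of tori, in the
basis attached to a vertex. -/
def VertexFrame.weights (S : P.VertexFrame) : (Fin d → ℂ) →L[ℝ] (Fin n → ℂ) :=
  ContinuousLinearMap.pi fun k => ∑ j, (S.expo k j : ℝ) • ContinuousLinearMap.proj j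

/-! ### The derivative of the monomials: equivariance, image and kernel -/

theorem VertexFrame.weights_apply (S : P.VertexFrame) (a : Fin d → ℂ) (k : Fin n) :
    S.weights a k = ∑ j, (S.expo k j : ℂ) * a j := by
  simp [VertexFrame.weights]

theorem VertexFrame.monomial_exp_mul (S : P.VertexFrame) (a z : Fin d → ℂ) :
    S.monomial (fun j => Complex.exp (a j) * z j)
      = fun k => Complex.exp (S.weights a k) * S.monomial z k := by
  ext k
  simp only [VertexFrame.monomial, mul_zpow, Finset.prod_mul_distrib, S.weights_apply,
    Complex.exp_sum, Complex.exp_int_mul]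

theorem hasDerivAt_exp_mul {m : ℕ} (a z : Fin m → ℂ) :
    HasDerivAt (fun (t : ℝ) j => Complex.exp ((t • a) j) * z j) (a * z) 0 := by
  refine hasDerivAt_pi.2 fun j => ?_
  have h1 : HasDerivAt (fun t : ℝ => (t : ℂ) * a j) (1 * a j) 0 :=
    (Complex.ofRealCLM.hasDerivAt (x := 0)).mul_const (a j)
  have h2 := (h1.cexp).mul_const (z j)
  simpa using h2

theorem contDiff_exp_mul {m : ℕ} (a z : Fin m → ℂ) :
    ContDiff ℝ ∞ (fun (t : ℝ) j => Complex.exp ((t • a) j) * z j) := by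
  refine contDiff_pi.2 fun j => ?_
  have h1 : ContDiff ℝ ∞ fun t : ℝ => (t • a) j := contDiff_id.smul contDiff_const
  exact h1.cexp.mul contDiff_const

theorem VertexFrame.hasFDerivAt_monomial (S : P.VertexFrame) {z : Fin d → ℂ}
    (hz : z ∈ S.nonvanishing) : HasFDerivAt S.monomial (fderiv ℝ S.monomial z) z :=
  ((S.contDiffAt_monomial hz).differentiableAt (by simp)).hasFDerivAt

/-- Differentiate the equivariance `monomial_exp_mul` along t ↦ exp(ta) z at t = 0; no product of
powers has to be differentiated. -/
theorem VertexFrame.fderiv_monomial_mul (S : P.VertexFrame) {z : Fin d → ℂ}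
    (hz : z ∈ S.nonvanishing) (a : Fin d → ℂ) :
    fderiv ℝ S.monomial z (a * z) = S.weights a * S.monomial z := by
  have h0 : (fun j => Complex.exp (((0 : ℝ) • a) j) * z j) = z := by simp
  have h1 := HasFDerivAt.comp_hasDerivAt (x := (0 : ℝ)) (l := S.monomial)
    (by rw [h0]; exact S.hasFDerivAt_monomial hz) (hasDerivAt_exp_mul a z)
  have h2 : S.monomial ∘ (fun (t : ℝ) j => Complex.exp ((t • a) j) * z j)
      = fun (t : ℝ) k => Complex.exp ((t • S.weights a) k) * S.monomial z k := by
    ext t : 1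
    rw [Function.comp_apply, S.monomial_exp_mul, map_smul]
  rw [h2] at h1
  exact h1.unique (hasDerivAt_exp_mul _ _)

/-- Along such u the unit factor is constant and the monomials are affine. This covers the
directions that a * z misses where vertex coordinates of z vanish. -/
theorem VertexFrame.fderiv_monomial_inner (S : P.VertexFrame) {z : Fin d → ℂ}
    (hz : z ∈ S.nonvanishing) {u : Fin d → ℂ} (hu : ∀ j, j ∉ Set.range S.σ → u j = 0) :
    fderiv ℝ S.monomial z u = fun k => u (S.σ k) * S.monomial (S.outer z) k := by
  have h1 := (S.hasFDerivAt_monomial hz).hasLineDerivAt u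
  have h2 : (fun t : ℝ => S.monomial (z + t • u))
      = fun (t : ℝ) k => (z (S.σ k) + t * u (S.σ k)) * S.monomial (S.outer z) k := by
    ext t k
    rw [S.monomial_eq, S.outer_congr (w := z) fun j hj => by simp [hu j hj]]
    simp
  rw [HasLineDerivAt, h2] at h1
  refine h1.unique (hasDerivAt_pi.2 fun k => ?_)
  have h3 : HasDerivAt (fun t : ℝ => (t : ℂ) * u (S.σ k)) (1 * u (S.σ k)) 0 :=
    (Complex.ofRealCLM.hasDerivAt (x := 0)).mul_const _
  simpa using (h3.const_add (z (S.σ k))).mul_const (S.monomial (S.outer z) k)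

theorem VertexFrame.fderiv_monomial_surjective (S : P.VertexFrame) {z : Fin d → ℂ}
    (hz : z ∈ S.nonvanishing) : Function.Surjective (fderiv ℝ S.monomial z) := by
  intro v
  refine ⟨S.replace (fun k => v k * (S.monomial (S.outer z) k)⁻¹) 0, ?_⟩
  rw [S.fderiv_monomial_inner hz fun j hj => S.replace_of_notMem _ _ hj]
  ext k
  rw [S.replace_σ, inv_mul_cancel_right₀ (S.monomial_outer_ne_zero hz k)]

/-- The kernel of the derivative of the quotient map consists of the velocities of one-parameter
subgroups of `N_ℂ`. -/
theorem VertexFrame.exists_mul_eq_of_fderiv_monomial_eq_zero (S : P.VertexFrame) {z : Fin d → ℂ}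
    (hz : z ∈ S.nonvanishing) {v : Fin d → ℂ} (hv : fderiv ℝ S.monomial z v = 0) :
    ∃ a, S.weights a = 0 ∧ a * z = v := by
  -- Outside the vertex a * z = v forces a = v / z. The entries at the vertex are then chosen to
  -- kill the weights, which restrict to the identity there.
  let a₀ : Fin d → ℂ := S.replace 0 (v / z)
  let a : Fin d → ℂ := S.replace (-S.weights a₀) a₀
  have ha : S.weights a = 0 := by
    have h1 : ∀ w : Fin n → ℂ, S.weights (S.replace w 0) = w := by
      intro w
      ext k
      rw [S.weights_apply, Finset.sum_eq_single (S.σ k)]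
      · simp [S.expo_σ, S.replace_σ]
      · intro j _ hj
        by_cases h : j ∈ Set.range S.σ
        · obtain ⟨l, rfl⟩ := h
          rw [S.expo_σ, if_neg fun h => hj (by rw [h])]
          simp
        · rw [S.replace_of_notMem _ _ h]
          simp
      · simp
    have h2 : a = a₀ + S.replace (-S.weights a₀) 0 := by
      ext j
      by_cases hj : j ∈ Set.range S.σ
      · obtain ⟨k, rfl⟩ := hj
        simp [a, a₀, S.replace_σ]
      · simp [a, S.replace_of_notMem _ _ hj]
    rw [h2, map_add, h1, add_neg_cancel]
  refine ⟨a, ha, ?_⟩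
  have h1 : ∀ j, j ∉ Set.range S.σ → (v - a * z) j = 0 := by
    intro j hj
    simp [a, a₀, S.replace_of_notMem _ _ hj, div_mul_cancel₀ _ (hz j hj)]
  -- The error v - a * z lives on the vertex coordinates, where the derivative is diagonal with
  -- non-zero entries.
  have h2 : fderiv ℝ S.monomial z (v - a * z) = 0 := by
    rw [map_sub, hv, S.fderiv_monomial_mul hz, ha, zero_mul, sub_zero]
  rw [S.fderiv_monomial_inner hz h1] at h2
  refine (sub_eq_zero.1 (funext fun j => ?_)).symm
  by_cases hj : j ∈ Set.range S.σ
  · obtain ⟨k, rfl⟩ := hj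
    exact (mul_eq_zero.1 (congrFun h2 k)).resolve_right (S.monomial_outer_ne_zero hz k)
  · exact h1 j hj

end DelzantPolytope

/-- Compose ξ with a linear section s of D: the vector v - s(D v) lies in ker D, on which ξ
vanishes. -/
theorem ContinuousLinearMap.exists_eq_comp_of_surjective {E F : Type*} [NormedAddCommGroup E]
    [NormedSpace ℝ E] [NormedAddCommGroup F] [NormedSpace ℝ F] [FiniteDimensional ℝ F]
    {D : E →L[ℝ] F} (hD : Function.Surjective D) {ξ : StrongDual ℝ E}
    (h : ∀ v, D v = 0 → ξ v = 0) : ∃ η : StrongDual ℝ F, ξ = η.comp D := by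
  obtain ⟨s, hs⟩ := (D : E →ₗ[ℝ] F).exists_rightInverse_of_surjective (LinearMap.range_eq_top.2 hD)
  refine ⟨ξ.comp (LinearMap.toContinuousLinearMap s), ContinuousLinearMap.ext fun v => ?_⟩
  have h1 : D (v - s (D v)) = 0 := by
    rw [map_sub, sub_eq_zero]
    exact (LinearMap.congr_fun hs (D v)).symm
  have h2 := h _ h1
  rwa [map_sub, sub_eq_zero] at h2

/-! ### The induced bivector on the quotient and the conormal spaces of fibres -/

namespace DelzantPolytope

variable {n d : ℕ} {P : DelzantPolytope n d}

variable (P) in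
/-- The vertex whose affine chart is the preferred chart at a point of `M_Δ`. -/
def frameAt (x : P.M) : P.VertexFrame := (P.exists_mem_chart_source x).choose

theorem mem_domain_frameAt (z : P.Sigma) : z ∈ (P.frameAt (P.proj z)).domain :=
  (P.frameAt (P.proj z)).proj_mem_chart_source.1 (P.exists_mem_chart_source (P.proj z)).choose_spec

/-- `frameAt` makes the same choice as `chartAt`, so p written in the preferred charts is
definitionally the monomial map. -/
theorem mfderiv_proj (z : P.Sigma) :
    mfderiv 𝓘(ℝ, Fin d → ℂ) 𝓘(ℝ, Fin n → ℂ) P.proj z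
      = fderiv ℝ (P.frameAt (P.proj z)).monomial z.1 :=
  (hasMFDerivAt_opens P.continuous_proj.continuousAt
    ((P.frameAt (P.proj z)).hasFDerivAt_monomial (mem_domain_frameAt z))
    (Filter.Eventually.of_forall fun _ => rfl)).mfderiv

/-- The infinitesimal action of `ℂ^d` on `ℂ^n` in the affine coordinates at a vertex. -/
def VertexFrame.action (S : P.VertexFrame) (w : Fin n → ℂ) : (Fin d → ℂ) →L[ℝ] (Fin n → ℂ) :=
  (ContinuousLinearMap.mul ℝ (Fin n → ℂ) w).comp S.weights

theorem VertexFrame.action_apply (S : P.VertexFrame) (w : Fin n → ℂ) (a : Fin d → ℂ) :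
    S.action w a = w * S.weights a := rfl

/-- The weights are integers, so the real linear map is complex linear; this is what lets positivity
act on it. -/
theorem VertexFrame.action_I_smul (S : P.VertexFrame) (w : Fin n → ℂ) (a : Fin d → ℂ) :
    S.action w (Complex.I • a) = Complex.I • S.action w a := by
  rw [S.action_apply, S.action_apply]
  ext k
  simp only [Pi.mul_apply, Pi.smul_apply, VertexFrame.weights_apply, smul_eq_mul, Finset.mul_sum]
  exact Finset.sum_congr rfl fun j _ => by ring

variable (P) in
/-- The infinitesimal action of `ℂ^d` on `M_Δ`. -/
def quotientAction (x : P.M) : (Fin d → ℂ) →L[ℝ] TangentSpace 𝓘(ℝ, Fin n → ℂ) x :=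
  (P.frameAt x).action ((P.frameAt x).coord x)

theorem quotientAction_apply (x : P.M) (a : Fin d → ℂ) :
    P.quotientAction x a = (P.frameAt x).coord x * (P.frameAt x).weights a := rfl

/-- Equivariance of p: the composite dp_z ∘ ρ_z depends on p z only, which is why the bivector
descends. -/
theorem mfderiv_proj_infinitesimalAction (z : P.Sigma) (a : Fin d → ℂ) :
    mfderiv 𝓘(ℝ, Fin d → ℂ) 𝓘(ℝ, Fin n → ℂ) P.proj z (P.infinitesimalAction z a)
      = P.quotientAction (P.proj z) a := by
  rw [mfderiv_proj, quotientAction_apply, VertexFrame.coord_proj, mul_comm]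
  exact VertexFrame.fderiv_monomial_mul _ (mem_domain_frameAt z) a

variable (P) in
/-- The bivector field on `M_Δ` which is induced by the action of `ℂ^d`. -/
def quotientBivector (π : Bivector (Fin d → ℂ)) : BivectorField (Fin n → ℂ) P.M :=
  fun x => π.map (P.quotientAction x)

theorem map_inducedBivector (π : Bivector (Fin d → ℂ)) (z : P.Sigma) :
    (P.inducedBivector π z).map (mfderiv 𝓘(ℝ, Fin d → ℂ) 𝓘(ℝ, Fin n → ℂ) P.proj z)
      = P.quotientBivector π (P.proj z) := by
  have h : (mfderiv 𝓘(ℝ, Fin d → ℂ) 𝓘(ℝ, Fin n → ℂ) P.proj z).comp (P.infinitesimalAction z)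
      = P.quotientAction (P.proj z) :=
    ContinuousLinearMap.ext fun a => mfderiv_proj_infinitesimalAction z a
  rw [quotientBivector, ← h]
  rfl

theorem isPoisson_inducedBivector (π : Bivector (Fin d → ℂ)) : (P.inducedBivector π).IsPoisson := by
  refine isPoisson_of_bracket_eq_logBracket π _ fun z ξ => ?_
  have h : (P.infinitesimalAction z : (Fin d → ℂ) →L[ℝ] (Fin d → ℂ))
      = ContinuousLinearMap.mul ℝ (Fin d → ℂ) z.1 :=
    ContinuousLinearMap.ext fun a => mul_comm a z.1
  rw [← h, mul_comm]
  rfl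

theorem isPoisson_quotientBivector (π : Bivector (Fin d → ℂ)) :
    (P.quotientBivector π).IsPoisson :=
  (isPoisson_inducedBivector π).of_map contMDiff_proj exists_section (map_inducedBivector π)

/-- The tangent space of a fibre is the kernel of the derivative of the quotient map. -/
theorem mem_tangentVectors_fibre_iff (z : P.Sigma) (v : TangentSpace 𝓘(ℝ, Fin d → ℂ) z) :
    v ∈ tangentVectors (Fin d → ℂ) (P.proj ⁻¹' {P.proj z}) z
      ↔ mfderiv 𝓘(ℝ, Fin d → ℂ) 𝓘(ℝ, Fin n → ℂ) P.proj z v = 0 := by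
  constructor
  · rintro ⟨γ, hγ, hmem, rfl, hv⟩
    have h1 : P.proj ∘ γ = fun _ => P.proj (γ 0) := funext hmem
    have h2 := mfderiv_comp (0 : ℝ) ((contMDiff_proj (P := P) (γ 0)).mdifferentiableAt (by simp))
      ((hγ 0).mdifferentiableAt (by simp))
    rw [h1, mfderiv_const] at h2
    have h3 := DFunLike.congr_fun h2 (1 : ℝ)
    have hv' : mfderiv 𝓘(ℝ, ℝ) 𝓘(ℝ, Fin d → ℂ) γ 0 (1 : ℝ) = v := hv
    rw [← hv']
    exact h3.symm
  · intro hv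
    rw [mfderiv_proj] at hv
    have hz := mem_domain_frameAt z
    obtain ⟨a, ha, hav⟩ :=
      (P.frameAt (P.proj z)).exists_mul_eq_of_fderiv_monomial_eq_zero hz hv
    -- A kernel vector is a * z with a of weight zero; the orbit t ↦ exp(ta) z has this velocity and
    -- keeps the monomials fixed, so it runs in the fibre.
    let c : ℝ → Fin d → ℂ := fun t j => Complex.exp ((t • a) j) * z.1 j
    have hc : ∀ t, c t ∈ P.Sigma := fun t =>
      P.smul_mem_sigma (fun j => Units.mk0 _ (Complex.exp_ne_zero ((t • a) j))) z.2
    let γ : ℝ → P.Sigma := fun t => ⟨c t, hc t⟩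
    have hγ : ContMDiff 𝓘(ℝ, ℝ) 𝓘(ℝ, Fin d → ℂ) ∞ γ :=
      (ContMDiff.subtypeVal_comp_iff _ _).1 (contDiff_exp_mul a z.1).contMDiff
    have hγ0 : γ 0 = z := Subtype.ext (funext fun j => by simp [γ, c])
    refine ⟨γ, hγ, fun t => ?_, hγ0, ?_⟩
    · have ht : γ t ∈ (P.frameAt (P.proj z)).domain := fun j hj =>
        mul_ne_zero (Complex.exp_ne_zero _) (hz j hj)
      rw [Set.mem_preimage, Set.mem_singleton_iff,
        (P.frameAt (P.proj z)).proj_eq_proj_iff ht hz]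
      refine ((P.frameAt (P.proj z)).monomial_exp_mul (t • a) z.1).trans ?_
      rw [map_smul, ha]
      simp
    · have h1 : mfderiv 𝓘(ℝ, ℝ) 𝓘(ℝ, Fin d → ℂ) c 0 = mfderiv 𝓘(ℝ, ℝ) 𝓘(ℝ, Fin d → ℂ) γ 0 := by
        have h := mfderiv_comp (0 : ℝ) ((contMDiff_subtype_val (n := ∞) (I := 𝓘(ℝ, Fin d → ℂ))
          (γ 0)).mdifferentiableAt (by simp)) ((hγ 0).mdifferentiableAt (by simp))
        rw [mfderiv_subtype_val] at h
        exact h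
      rw [← hav]
      have h2 := (hasDerivAt_exp_mul a z.1).hasFDerivAt.hasMFDerivAt.mfderiv
      refine (DFunLike.congr_fun (h1.symm.trans h2) (1 : ℝ)).trans ?_
      exact one_smul ℝ (a * z.1)

/-- The conormal space of a fibre consists of the pull-backs of covectors on `M_Δ`. -/
theorem mem_conormalSpace_fibre_iff (z : P.Sigma)
    (ξ : StrongDual ℝ (TangentSpace 𝓘(ℝ, Fin d → ℂ) z)) :
    ξ ∈ conormalSpace (Fin d → ℂ) (P.proj ⁻¹' {P.proj z}) z
      ↔ ∃ η : StrongDual ℝ (TangentSpace 𝓘(ℝ, Fin n → ℂ) (P.proj z)),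
        ξ = η.comp (mfderiv 𝓘(ℝ, Fin d → ℂ) 𝓘(ℝ, Fin n → ℂ) P.proj z) := by
  have hmem : ξ ∈ conormalSpace (Fin d → ℂ) (P.proj ⁻¹' {P.proj z}) z
      ↔ ∀ v, mfderiv 𝓘(ℝ, Fin d → ℂ) 𝓘(ℝ, Fin n → ℂ) P.proj z v = 0 → ξ v = 0 :=
    forall_congr' fun v => by rw [mem_tangentVectors_fibre_iff]
  rw [hmem]
  refine ⟨fun h => ?_, ?_⟩
  · rw [mfderiv_proj] at h ⊢
    have hs := (P.frameAt (P.proj z)).fderiv_monomial_surjective (mem_domain_frameAt z)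
    exact ContinuousLinearMap.exists_eq_comp_of_surjective hs h
  · rintro ⟨η, rfl⟩ v hv
    rw [ContinuousLinearMap.comp_apply, hv, map_zero]

variable (P) in
/-- The subspace `{π♯ (η ∘ A) | η}` of `ℂ^d`, where `A` is the infinitesimal action on `M_Δ`. -/
def conormalDirections (π : Bivector (Fin d → ℂ)) (x : P.M) : Submodule ℝ (Fin d → ℂ) :=
  LinearMap.range (π.sharp ∘ₗ
    ((ContinuousLinearMap.compL ℝ (Fin d → ℂ) (Fin n → ℂ) ℝ).flip
      (P.quotientAction x : (Fin d → ℂ) →L[ℝ] (Fin n → ℂ))).toLinearMap)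

/-- π_Σ♯(η ∘ dp) = ρ(π♯(η ∘ dp ∘ ρ)) and dp ∘ ρ is the action on M_Δ, so only the outer ρ varies
along a fibre. -/
theorem conormalImage_fibre (π : Bivector (Fin d → ℂ)) (z : P.Sigma) :
    (P.inducedBivector π).conormalImage (P.proj ⁻¹' {P.proj z}) z
      = (P.conormalDirections π (P.proj z)).map (P.infinitesimalAction z).toLinearMap := by
  have hcomp : ∀ η : StrongDual ℝ (TangentSpace 𝓘(ℝ, Fin n → ℂ) (P.proj z)),
      (η.comp (mfderiv 𝓘(ℝ, Fin d → ℂ) 𝓘(ℝ, Fin n → ℂ) P.proj z)).comp (P.infinitesimalAction z)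
        = η.comp (P.quotientAction (P.proj z)) := fun η =>
    ContinuousLinearMap.ext fun a => congrArg η (mfderiv_proj_infinitesimalAction z a)
  ext v
  constructor
  · rintro ⟨ξ, hξ, rfl⟩
    obtain ⟨η, rfl⟩ := (mem_conormalSpace_fibre_iff z ξ).1 hξ
    refine ⟨_, ⟨η, rfl⟩, ?_⟩
    exact congrArg (fun ζ => P.infinitesimalAction z (π.sharp ζ)) (hcomp η).symm
  · rintro ⟨_, ⟨η, rfl⟩, rfl⟩
    refine ⟨_, (mem_conormalSpace_fibre_iff z _).2 ⟨η, rfl⟩, ?_⟩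
    exact congrArg (fun ζ => P.infinitesimalAction z (π.sharp ζ)) (hcomp η)

/-! ### Positivity and coregularity of the fibres -/

theorem eq_zero_of_mem_conormalDirections {π : Bivector (Fin d → ℂ)} (hπ : π.IsPositive)
    {x : P.M} {a : Fin d → ℂ} (ha : a ∈ P.conormalDirections π x)
    (h : P.quotientAction x a = 0) : a = 0 := by
  obtain ⟨η, rfl⟩ := ha
  exact hπ.sharp_comp_eq_zero (X := Fin n → ℂ) (P.quotientAction x)
    ((P.frameAt x).action_I_smul _) η h

/-- Injectivity of dp ∘ ρ on the conormal directions gives both conditions: ρ sends a fixed basis to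
a frame, and no non-zero vector of the image lies in ker dp. -/
theorem isCoregular_fibre {π : Bivector (Fin d → ℂ)} (hπ : π.IsPositive) (y : P.M) :
    (P.inducedBivector π).IsCoregular (P.proj ⁻¹' {y}) := by
  refine ⟨isEmbeddedSubmanifold_fibre y, ?_, ?_⟩
  · intro x hx
    let b := Module.finBasis ℝ (P.conormalDirections π y)
    refine ⟨Set.univ, _, fun i z => P.infinitesimalAction z (b i), isOpen_univ, Set.mem_univ x,
      fun i => ?_, ?_⟩
    · have hv : ContDiff ℝ ∞ fun z : Fin d → ℂ => (b i : Fin d → ℂ) * z :=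
        contDiff_const.mul contDiff_id
      exact (contMDiff_vectorField_opens hv).contMDiffOn
    · rintro z ⟨rfl, -⟩
      have hspan : Submodule.span ℝ (Set.range fun i => (b i : Fin d → ℂ))
          = P.conormalDirections π (P.proj z) := by
        have h1 := congrArg (Submodule.map (P.conormalDirections π (P.proj z)).subtype) b.span_eq
        rw [Submodule.map_span, Submodule.map_top, Submodule.range_subtype, ← Set.range_comp] at h1
        exact h1
      have hinj : ∀ a ∈ P.conormalDirections π (P.proj z),
          P.infinitesimalAction z a = 0 → a = 0 := fun a ha h0 => by
        refine eq_zero_of_mem_conormalDirections hπ ha ?_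
        rw [← mfderiv_proj_infinitesimalAction, h0, map_zero]
      constructor
      · have h1 : LinearIndependent ℝ
            (((P.infinitesimalAction z).toLinearMap ∘ₗ
              (P.conormalDirections π (P.proj z)).subtype) ∘ b) := by
          refine b.linearIndependent.map' _ (LinearMap.ker_eq_bot'.2 fun a ha => ?_)
          exact Subtype.ext (hinj a a.2 ha)
        exact h1
      · rw [conormalImage_fibre]
        have h1 := congrArg (Submodule.map (P.infinitesimalAction z).toLinearMap) hspan
        rw [Submodule.map_span, ← Set.range_comp] at h1
        exact h1
  · rintro x rfl v hv hvt
    rw [conormalImage_fibre] at hv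
    obtain ⟨a, ha, rfl⟩ := hv
    have h1 : P.quotientAction (P.proj x) a = 0 := by
      rw [← mfderiv_proj_infinitesimalAction]
      exact (mem_tangentVectors_fibre_iff x _).1 hvt
    rw [eq_zero_of_mem_conormalDirections hπ ha h1, map_zero]

end DelzantPolytope

end

theorem mainTheorem6 {n d : ℕ} (P : DelzantPolytope n d) (π : Bivector (Fin d → ℂ))
    (hπ : π.IsPositive) :
    (P.inducedBivector π).IsPoisson ∧
      ∃! πM : BivectorField (Fin n → ℂ) P.M,
        πM.IsPoisson ∧ IsCoregularPoissonSubmersion (P.inducedBivector π) πM P.proj := by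
  open DelzantPolytope in
  refine ⟨isPoisson_inducedBivector π, P.quotientBivector π, ⟨isPoisson_quotientBivector π, ?_⟩, ?_⟩
  · exact {
      poisson_source := isPoisson_inducedBivector π
      poisson_target := isPoisson_quotientBivector π
      surjective := P.proj_surjective
      submersion := isSubmersion_proj
      poisson_map := map_inducedBivector π
      coregular_fibres := isCoregular_fibre hπ }
  · rintro πM ⟨-, h⟩
    funext x
    obtain ⟨z, rfl⟩ := P.proj_surjective x
    -- The Poisson map condition alone prescribes the bivector at p z.
    rw [← h.poisson_map z, map_inducedBivector]
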